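/- Let $\Gamma=(V,E,\ell)$ be a finite simplicial graph with even edge labels $\ell(e)=2\tilde\ell(e)$, $\tilde\ell(e)\ge 1$, and let $$A_\Gamma=\langle g_v,\ v\in V \mid (g_vg_w)^{\tilde\ell(e)}=(g_wg_v)^{\tilde\ell(e)},\ e=\{v,w\}\in E\rangle$$ be the associated even Artin-Tits group. Let $\chi:A_\Gamma\to\mathbb{Z}$ be an epimorphism that is non-resonant, that is, $m_v:=\chi(g_v)\neq 0$ for all $v\in V$; put $m_e:=m_v+m_w$ for $e=\{v,w\}\in E$. Let $\mathbb{K}$ be a field of characteristic zero, let $A_\Gamma^\chi:=\ker\chi$, and regard $H_1(A_\Gamma^\chi;\mathbb{K})$ as a $\mathbb{K}[t^{\pm1}]$-module, where $t$ acts by conjugation $x\mapsto gxg^{-1}$ by an element $g\in A_\Gamma$ with $\chi(g)=1$. Let $$\mathbb{T}_\Gamma=\bigcup_{v\in V}\{d>1 : d\mid m_v\}\ \cup\ \bigcup_{e\in E}\{d>1 : d\mid\tilde\ell(e)m_e,\ d\nmid m_e\}.$$ Let $\partial_1:C_1\to C_0$ and $\partial_0:C_0\to\mathbb{K}$ be the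 boundary map from edges to vertices and the augmentation in the chain complex over $\mathbb{K}$ of the finite type flag complex of $\Gamma$ (the simplicial complex on $V$ whose simplices are the nonempty vertex sets of complete subgraphs $X$ of $\Gamma$ with finite Coxeter group $W_X$; its vertices and edges are those of $\Gamma$). Put $r_0=\dim_{\mathbb{K}}(\ker\partial_0/\operatorname{im}\partial_1)$, the dimension of its reduced homology in degree $0$, and let $\Phi_d$ be the $d$-th cyclotomic polynomial. Then there are integers $n_{0,j}(d)\ge 0$ ($d\in\mathbb{T}_\Gamma$, $j\geq 1$) with $$H_1(A_\Gamma^\chi;\mathbb{K})\cong\mathbb{K}[t^{\pm1}]^{r_0}\oplus\left(\frac{\mathbb{K}[t^{\pm1}]}{(t-1)}\right)^{\dim_{\mathbb{K}}\operatorname{im}\partial_1}\oplus\bigoplus_{d\in\mathbb{T}_\Gamma}\bigoplus_{j=1}^{\infty}\left(\frac{\mathbb{K}[t^{\pm1}]}{(\Phi_d(t)^j)}\right)^{n_{0,j}(d)}$$ as $\mathbb{K}[t^{\pm1}]$-modules, and for every such decomposition $n_{0,j}(d)=0$ for all $j>2$, so that $$H_1(A_\Gamma^\chi;\mathbb{K})\cong\mathbb{K}[t^{\pm1}]^{r_0}\oplus\left(\frac{\mathbb{K}[t^{\pm1}]}{(t-1)}\right)^{\dim_{\mathbb{K}}\operatorname{im}\partial_1}\oplus\bigoplus_{d\in\mathbb{T}_\Gamma}\left[\left(\frac{\mathbb{K}[t^{\pm1}]}{(\Phi_d(t))}\right)^{n_{0,1}(d)}\oplus\left(\frac{\mathbb{K}[t^{\pm1}]}{(\Phi_d(t)^2)}\right)^{n_{0,2}(d)}\right].$$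 -/

import Mathlib

universe u

open scoped DirectSum LaurentPolynomial

noncomputable section

/-- The dimension of `ker f' / im f`, for linear maps `f : M → N` and `f' : N → P` whose composite
is zero. -/
def homologyDim (K : Type u) [Field K] {M N P : Type u} [AddCommGroup M] [Module K M]
    [AddCommGroup N] [Module K N] [AddCommGroup P] [Module K P]
    (f : M →ₗ[K] N) (f' : N →ₗ[K] P) : ℕ :=
  Module.finrank K (LinearMap.ker f' ⧸ (LinearMap.range f).submoduleOf (LinearMap.ker f'))

/-- A simplicial graph on the vertex set `V` whose edges `e` carry even labels `ℓ(e) > 1`. -/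
structure EvenLabeledGraph (V : Type u) where
  /-- the underlying simplicial graph -/
  graph : SimpleGraph V
  /-- the label `ℓ` -/
  label : graph.edgeSet → ℕ
  one_lt_label : ∀ e, 1 < label e
  even_label : ∀ e, Even (label e)

namespace EvenLabeledGraph

variable {V : Type u} (Γ : EvenLabeledGraph V)

/-- `ℓ̃({v, w}) = ℓ({v, w}) / 2` for an edge `{v, w}`. -/
def halfLabel {v w : V} (h : Γ.graph.Adj v w) : ℕ :=
  Γ.label ⟨s(v, w), h⟩ / 2

/-- The relators `(g_v g_w)^k (g_w g_v)^{-k}`, for `{v, w}` an edge with label `2 k`. -/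
def relators : Set (FreeGroup V) :=
  {r | ∃ (v w : V) (h : Γ.graph.Adj v w),
    r = (FreeGroup.of v * FreeGroup.of w) ^ Γ.halfLabel h *
      ((FreeGroup.of w * FreeGroup.of v) ^ Γ.halfLabel h)⁻¹}

/-- The even Artin-Tits group `A_Γ`. -/
abbrev ArtinGroup : Type u := PresentedGroup Γ.relators

/-- The standard generator `g_v` of `A_Γ`. -/
def gen (v : V) : Γ.ArtinGroup := PresentedGroup.of v

variable {Γ}

/-- The integer `m_v = χ(g_v)`. -/
def weight (χ : Γ.ArtinGroup →* Multiplicative ℤ) (v : V) : ℤ :=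
  Multiplicative.toAdd (χ (Γ.gen v))

/-- `χ` is non-resonant if no standard generator is sent to zero. -/
def NonResonant (χ : Γ.ArtinGroup →* Multiplicative ℤ) : Prop :=
  ∀ v : V, weight χ v ≠ 0

/-- The set `𝕋_Γ` of the integers `d > 1` such that `d ∣ m_v` for some vertex `v`, or
`d ∣ ℓ̃(e) m_e` and `d ∤ m_e` for some edge `e = {v, w}`, where `m_e = m_v + m_w`. -/
def torsionOrders (χ : Γ.ArtinGroup →* Multiplicative ℤ) : Set ℕ :=
  {d | 1 < d ∧
    ((∃ v : V, (d : ℤ) ∣ weight χ v) ∨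
      ∃ (v w : V) (h : Γ.graph.Adj v w),
        (d : ℤ) ∣ (Γ.halfLabel h : ℤ) * (weight χ v + weight χ w) ∧
          ¬ (d : ℤ) ∣ weight χ v + weight χ w)}

/-! ### Low degrees of the finite type flag complex

The Coxeter groups of one vertex and of one edge are finite (cyclic of order two and dihedral), so
the vertices and the edges of the finite type flag complex are those of `Γ`. -/

variable (Γ) (K : Type u) [Field K]

/-- The boundary map `∂₁` from `1`-chains to `0`-chains. Every edge is used with both of its
orientations, so that no order on the vertices has to be chosen; this does not change the image. -/
def flagBoundary₁ : (Γ.graph.Dart →₀ K) →ₗ[K] (V →₀ K) :=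
  Finsupp.linearCombination K
    fun e : Γ.graph.Dart => Finsupp.single e.snd (1 : K) - Finsupp.single e.fst (1 : K)

/-- The augmentation `∂₀ : C₀ → C₋₁ = K`. -/
def flagAugmentation : (V →₀ K) →ₗ[K] K :=
  Finsupp.linearCombination K fun _ : V => (1 : K)

/-- `r₀`, the dimension of the reduced homology `ker ∂₀ / im ∂₁` of the finite type flag complex
in degree zero. -/
def freeRank : ℕ :=
  homologyDim K (Γ.flagBoundary₁ K) (flagAugmentation K)

/-- The dimension of `im ∂₁`. -/
def boundaryRank : ℕ :=
  Module.finrank K (LinearMap.range (Γ.flagBoundary₁ K))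

end EvenLabeledGraph

/-! ### Homology of the kernel of a character -/

section KernelHomology

variable (K : Type u) [Field K] {G : Type u} [Group G]

/-- The map `H_n(G; K) → H_n(H; K)` on homology with trivial coefficients that is induced by a
group homomorphism `f : G → H`. -/
def trivialHomologyMap {H : Type u} [Group H] (f : G →* H) (n : ℕ) :
    groupHomology (Rep.trivial K G K) n →ₗ[K] groupHomology (Rep.trivial K H K) n :=
  (groupHomology.map f (A := Rep.trivial K G K) (B := Rep.trivial K H K)
    (Rep.ofHom ⟨LinearMap.id, fun _ => rfl⟩) n).hom

theorem trivialHomologyMap_id (n : ℕ) :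
    trivialHomologyMap K (MonoidHom.id G) n = LinearMap.id :=
  congrArg ModuleCat.Hom.hom (groupHomology.map_id (A := Rep.trivial K G K) n)

theorem trivialHomologyMap_comp {H L : Type u} [Group H] [Group L] (f : G →* H) (f' : H →* L)
    (n : ℕ) : trivialHomologyMap K (f'.comp f) n =
      trivialHomologyMap K f' n ∘ₗ trivialHomologyMap K f n :=
  congrArg ModuleCat.Hom.hom (groupHomology.map_comp (A := Rep.trivial K G K)
    (B := Rep.trivial K H K) (C := Rep.trivial K L K) f f'
    (Rep.ofHom ⟨LinearMap.id, fun _ => rfl⟩) (Rep.ofHom ⟨LinearMap.id, fun _ => rfl⟩) n)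

/-- The action of `G` on `H_n(ker χ; K)` induced by conjugation: `a` acts by the map induced by
`x ↦ a x a⁻¹` on `ker χ`. -/
def conjOnKerHomology (χ : G →* Multiplicative ℤ) (n : ℕ) :
    Representation K G (groupHomology (Rep.trivial K χ.ker K) n) where
  toFun a := trivialHomologyMap K (MulAut.conjNormal a : MulAut χ.ker).toMonoidHom n
  map_one' := by
    have h : (MulAut.conjNormal (1 : G) : MulAut χ.ker).toMonoidHom = MonoidHom.id _ := by
      ext x; simp
    rw [h, trivialHomologyMap_id]
    rfl
  map_mul' a b := by
    have h : (MulAut.conjNormal (a * b) : MulAut χ.ker).toMonoidHom =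
        (MulAut.conjNormal a : MulAut χ.ker).toMonoidHom.comp
          (MulAut.conjNormal b : MulAut χ.ker).toMonoidHom := by
      ext x; simp [mul_assoc]
    rw [h, trivialHomologyMap_comp]
    rfl

/-- The homology `H_n(ker χ; K)`, to be regarded as a `K[t^{±1}]`-module with `t` acting by
conjugation by `g`. If `χ(g) = 1`, this is the action of the generator of `G / ker χ ≅ ℤ`. -/
def KerHomology (χ : G →* Multiplicative ℤ) (_g : G) (n : ℕ) : Type u :=
  groupHomology (Rep.trivial K χ.ker K) n

variable (χ : G →* Multiplicative ℤ) (g : G) (n : ℕ)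

instance : AddCommGroup (KerHomology K χ g n) :=
  inferInstanceAs (AddCommGroup (groupHomology (Rep.trivial K χ.ker K) n))

instance : Module K (KerHomology K χ g n) :=
  inferInstanceAs (Module K (groupHomology (Rep.trivial K χ.ker K) n))

/-- The algebra homomorphism `K[t^{±1}] → End_K H_n(ker χ; K)` that sends `t` to the action
of `g`. -/
def laurentAction : K[T;T⁻¹] →ₐ[K] Module.End K (KerHomology K χ g n) :=
  AddMonoidAlgebra.lift K (Module.End K (KerHomology K χ g n)) ℤ
    ((conjOnKerHomology K χ n).comp (zpowersHom G g))

instance : Module K[T;T⁻¹] (KerHomology K χ g n) :=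
  Module.compHom _ (laurentAction K χ g n).toRingHom

theorem KerHomology.T_one_smul (x : KerHomology K χ g n) :
    (LaurentPolynomial.T 1 : K[T;T⁻¹]) • x = conjOnKerHomology K χ n g x := by
  have h : zpowersHom G g (Multiplicative.ofAdd 1) = g := by simp [zpowersHom_apply]
  have h' : laurentAction K χ g n (LaurentPolynomial.T 1) =
      (1 : K) • conjOnKerHomology K χ n (zpowersHom G g (Multiplicative.ofAdd 1)) :=
    AddMonoidAlgebra.lift_single _ _ _
  change laurentAction K χ g n (LaurentPolynomial.T 1) x = _
  rw [h', h, one_smul]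
  rfl

end KernelHomology

/-! ### The modules in the decompositions -/

/-- `K[t^{±1}] / (t - 1)`. -/
abbrev TrivialSummand (K : Type u) [Field K] : Type u :=
  K[T;T⁻¹] ⧸ Ideal.span {(LaurentPolynomial.T 1 - 1 : K[T;T⁻¹])}

/-- `K[t^{±1}] / (Φ_d(t) ^ j)`. -/
abbrev CyclotomicSummand (K : Type u) [Field K] (d j : ℕ) : Type u :=
  K[T;T⁻¹] ⧸ Ideal.span {(Polynomial.toLaurent (Polynomial.cyclotomic d K) ^ j : K[T;T⁻¹])}

end

/-! Write `R = K[t^{±1}]` and `e_v` for the basis of `R^V`. Fox calculus presents `H_1(ker χ; K)` as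
the quotient of `R^V` by the Fox derivatives of the relators and of one word `w` representing `g`;
the extra relation turns the Alexander module of `(A_Γ, χ)` into the homology of the kernel
(`nonempty_kerHomology_equiv`). With `t^{m_v} - 1 = (t - 1) u_v` and `q_e = ∑_{i < ℓ̃(e)} t^{i
m_e}`, the relation of an edge `{a, b}` is `-(t - 1) q_e (u_b e_a - u_a e_b)`, while the row `b₀` of
`w` satisfies `∑ b₀(v) u_v = 1`.

The bound on exponents comes from `D = (t - 1) ∏_{d ∈ 𝕋_Γ} Φ_d²`, which kills all torsion. If `D` is
a multiple of every `u_v` and every `(t - 1) q_e u_a u_b`, the vectors `(D / u_v) e_v` agree modulo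
the relations along each connected component, which forces `D x = 0` for torsion `x`
(`smul_mem_span_of_smul_mem_span`). The squares suffice: if `Φ_d` with `d > 1` divides both `u_a`
and `u_b`, then `d ∣ m_e`, so `Φ_d` does not divide `q_e` (`prod_mul_prod_dvd`). A summand `R /
(Φ_d^j)` with `j > 2` would need `Φ_d^3 ∣ D`, contradicting coprimality of distinct cyclotomic
polynomials (`eq_zero_of_two_lt`).

For existence, the presentation is already defined over `ℚ`, where the `Φ_d` are prime. Smith normal
form there gives a diagonal presentation whose nonzero entries divide `D`, hence are products of `(t
- 1)^ε`, `ε ≤ 1`, and powers of `Φ_d`. This diagonal form survives extension to `K`, and the Chinese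
remainder theorem splits the cyclic modules. The numbers of free and `(t - 1)` summands follow from
the ranks of the presentation at two points: rank `1` at `t = 1`, where every edge relation vanishes
(`finrank_span_eval_one`), and rank `dim im ∂₁ + 1` at `t = 2`, where no factor of `D` vanishes
(`finrank_span_eval_two`). -/

noncomputable section

/-! ### The first homology of the kernel of a character -/

section KernelClasses

open LaurentPolynomial

variable (K : Type u) [Field K] {G : Type u} [Group G] (χ : G →* Multiplicative ℤ) (g : G)

/-- The class in `H_1(ker χ; K)` of an element of `ker χ`, as an additive map in the
coefficient. -/
def kerClass (x : χ.ker) : K →ₗ[K] KerHomology K χ g 1 :=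
  (groupHomology.H1π (Rep.trivial K χ.ker K)).hom ∘ₗ
    (groupHomology.cycles₁IsoOfIsTrivial (Rep.trivial K χ.ker K)).inv.hom ∘ₗ
      Finsupp.lsingle (M := K) x

variable {K χ g}

theorem kerClass_mul (x y : χ.ker) (a : K) :
    kerClass K χ g (x * y) a = kerClass K χ g x a + kerClass K χ g y a := by
  have h := congrArg (fun f => f a)
    ((groupHomology.mkH1OfIsTrivial (Rep.trivial K χ.ker K)).map_add
      (Additive.ofMul (Abelianization.of x)) (Additive.ofMul (Abelianization.of y)))
  exact h

theorem kerHomology_induction {p : KerHomology K χ g 1 → Prop}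
    (h0 : p 0) (hadd : ∀ x y, p x → p y → p (x + y)) (hc : ∀ x a, p (kerClass K χ g x a))
    (z : KerHomology K χ g 1) : p z := by
  induction z using groupHomology.H1_induction_on with
  | h z =>
    obtain ⟨y, rfl⟩ : ∃ y : χ.ker →₀ K, z =
        (groupHomology.cycles₁IsoOfIsTrivial (Rep.trivial K χ.ker K)).inv y := ⟨z.1, rfl⟩
    induction y using Finsupp.induction_linear with
    | zero => rw [map_zero, map_zero]; exact h0
    | add f f' hf hf' => rw [map_add, map_add]; exact hadd _ _ hf hf'
    | single x a => exact hc x a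

/-- First homology with trivial coefficients is the abelianization tensored with `K`, and a
homomorphism to an abelian group factors through the abelianization. The tensor product is over `ℤ`,
so linearity over `K` is checked afterwards on classes. -/
theorem exists_kerHomology_lift {Q : Type*} [AddCommGroup Q] [Module K Q]
    (f : χ.ker →* Multiplicative Q) :
    ∃ L : KerHomology K χ g 1 →ₗ[K] Q, ∀ x a, L (kerClass K χ g x a) =
      a • Multiplicative.toAdd (f x) := by
  let F : Additive (Abelianization χ.ker) →+ Q :=
    MonoidHom.toAdditiveLeft (Abelianization.lift f)
  let B : Additive (Abelianization χ.ker) →ₗ[ℤ] K →ₗ[ℤ] Q :=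
    LinearMap.mk₂ ℤ (fun x a => a • F x) (fun x y a => by rw [map_add, smul_add])
      (fun c x a => by rw [map_zsmul, smul_comm]) (fun x a b => add_smul a b (F x))
      (fun c x a => smul_assoc c a (F x))
  let L₀ : KerHomology K χ g 1 →+ Q := (TensorProduct.lift B).toAddMonoidHom.comp
    (groupHomology.H1AddEquivOfIsTrivial (Rep.trivial K χ.ker K)).toAddMonoidHom
  have hL : ∀ x a, L₀ (kerClass K χ g x a) = a • Multiplicative.toAdd (f x) := by
    intro x a
    have h := groupHomology.H1AddEquivOfIsTrivial_single (A := Rep.trivial K χ.ker K) x a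
    exact congrArg (TensorProduct.lift B) h
  refine ⟨{ toFun := L₀, map_add' := map_add L₀, map_smul' := fun c z => ?_ }, hL⟩
  induction z using kerHomology_induction with
  | h0 => simp
  | hadd x y hx hy => simp_all
  | hc x a => rw [← map_smul, hL]; simp [hL, mul_smul]

theorem conj_kerClass (y : G) (x : χ.ker) (a : K) :
    conjOnKerHomology K χ 1 y (kerClass K χ g x a) =
      kerClass K χ g (MulAut.conjNormal y x) a := by
  have h := congrArg (fun f => f.hom ((groupHomology.cycles₁IsoOfIsTrivial
    (Rep.trivial K χ.ker K)).inv (Finsupp.single (M := K) x a)))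
    (groupHomology.H1π_comp_map (A := Rep.trivial K χ.ker K) (B := Rep.trivial K χ.ker K)
    (MulAut.conjNormal y : MulAut χ.ker).toMonoidHom (Rep.ofHom ⟨LinearMap.id, fun _ => rfl⟩))
  refine h.trans (congrArg (groupHomology.H1π (Rep.trivial K χ.ker K)).hom ?_)
  apply Subtype.ext
  refine (groupHomology.coe_mapCycles₁ (A := Rep.trivial K χ.ker K)
    (B := Rep.trivial K χ.ker K) _ _ _).trans ?_
  rw [groupHomology.cycles₁IsoOfIsTrivial_inv_apply]
  simp [groupHomology.chainsMap₁]
  rfl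

theorem T_smul_kerHomology (n : ℤ) (x : KerHomology K χ g 1) :
    (T n : K[T;T⁻¹]) • x = conjOnKerHomology K χ 1 (g ^ n) x := by
  have h : zpowersHom G g (Multiplicative.ofAdd n) = g ^ n := by simp [zpowersHom_apply]
  have h' : laurentAction K χ g 1 (T n) =
      (1 : K) • conjOnKerHomology K χ 1 (zpowersHom G g (Multiplicative.ofAdd n)) :=
    AddMonoidAlgebra.lift_single _ _ _
  change laurentAction K χ g 1 (T n) x = _
  rw [h', h, one_smul]
  rfl

theorem T_smul_kerClass (n : ℤ) (x : χ.ker) (a : K) :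
    (T n : K[T;T⁻¹]) • kerClass K χ g x a = kerClass K χ g (MulAut.conjNormal (g ^ n) x) a := by
  rw [T_smul_kerHomology, conj_kerClass]

theorem C_smul_kerHomology (a : K) (x : KerHomology K χ g 1) :
    (C a : K[T;T⁻¹]) • x = a • x := by
  change laurentAction K χ g 1 (C a) x = _
  rw [C_eq_algebraMap, AlgHom.commutes]
  rfl

/-- A linear map that commutes with all powers of `t` is linear over Laurent polynomials. -/
theorem map_laurent_smul {M N : Type*} [AddCommGroup M] [Module K M] [AddCommGroup N]
    [Module K N] [Module K[T;T⁻¹] M] [Module K[T;T⁻¹] N] (L : M →ₗ[K] N)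
    (hM : ∀ (a : K) (x : M), (C a : K[T;T⁻¹]) • x = a • x)
    (hN : ∀ (a : K) (x : N), (C a : K[T;T⁻¹]) • x = a • x)
    (hT : ∀ (n : ℤ) (x : M), L ((T n : K[T;T⁻¹]) • x) = (T n : K[T;T⁻¹]) • L x)
    (p : K[T;T⁻¹]) (x : M) : L (p • x) = p • L x := by
  induction p using LaurentPolynomial.induction_on' with
  | add p q hp hq => simp [add_smul, hp, hq]
  | C_mul_T n a => rw [mul_smul, hM, map_smul, hT, mul_smul, hN]

end KernelClasses

/-! ### Crossed homomorphisms and Fox derivatives -/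

section Crossed

open LaurentPolynomial

variable {A : Type*} [CommRing A] {G : Type*} [Group G] {Q : Type*} [AddCommGroup Q]
  [Module A[T;T⁻¹] Q]

/-- `δ : G → Q` is a crossed homomorphism, where `G` acts on `Q` through `χ : G → ℤ = ⟨t⟩`. -/
def IsCrossed (A : Type*) [CommRing A] {G : Type*} [Group G] {Q : Type*} [AddCommGroup Q]
    [Module A[T;T⁻¹] Q] (χ : G →* Multiplicative ℤ) (δ : G → Q) : Prop :=
  ∀ x y, δ (x * y) = δ x + (T (χ x).toAdd : A[T;T⁻¹]) • δ y

variable {χ : G →* Multiplicative ℤ} {δ δ' : G → Q}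

theorem IsCrossed.map_one (h : IsCrossed A χ δ) : δ 1 = 0 := by
  simpa using h 1 1

theorem IsCrossed.map_inv (h : IsCrossed A χ δ) (x : G) :
    δ x⁻¹ = -((T (-(χ x).toAdd) : A[T;T⁻¹]) • δ x) := by
  have h1 := h x⁻¹ x
  rw [inv_mul_cancel, h.map_one] at h1
  simpa using eq_neg_of_add_eq_zero_left h1.symm

theorem IsCrossed.map_pow (h : IsCrossed A χ δ) (x : G) (n : ℕ) :
    δ (x ^ n) = (∑ i ∈ Finset.range n, (T (χ x).toAdd : A[T;T⁻¹]) ^ i) • δ x := by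
  induction n with
  | zero => simp [h.map_one]
  | succ n ih =>
    rw [pow_succ, h, ih, Finset.sum_range_succ, add_smul, T_pow]
    simp

/-- The two contributions of `x` cancel because `y` acts trivially. This is what makes a crossed
homomorphism, restricted to `ker χ`, compatible with the action of `t`. -/
theorem IsCrossed.conj (h : IsCrossed A χ δ) (x y : G) (hy : χ y = 1) :
    δ (x * y * x⁻¹) = (T (χ x).toAdd : A[T;T⁻¹]) • δ y := by
  rw [h, h, h.map_inv, map_mul, hy, mul_one, smul_neg, ← mul_smul, ← T_add]
  simp

theorem IsCrossed.zpow_eq_zero (h : IsCrossed A χ δ) {x : G} (hx : δ x = 0) (n : ℤ) :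
    δ (x ^ n) = 0 := by
  have h1 : ∀ n : ℕ, δ (x ^ n) = 0 := fun n => by rw [h.map_pow, hx, smul_zero]
  cases n with
  | ofNat n => simpa using h1 n
  | negSucc n => rw [zpow_negSucc, h.map_inv, h1, smul_zero, neg_zero]

/-- The value of a crossed homomorphism on the relator of an edge. -/
theorem IsCrossed.map_relator (h : IsCrossed A χ δ) (x y : G) (k : ℕ) :
    δ ((x * y) ^ k * ((y * x) ^ k)⁻¹) =
      (∑ i ∈ Finset.range k, (T ((χ x).toAdd + (χ y).toAdd) : A[T;T⁻¹]) ^ i) •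
        ((1 - T (χ y).toAdd : A[T;T⁻¹]) • δ x - (1 - T (χ x).toAdd : A[T;T⁻¹]) • δ y) := by
  -- Both powers have the same `χ`-value, so the inverse contributes exactly `-δ ((y * x) ^ k)`.
  have e : χ ((y * x) ^ k) = χ ((x * y) ^ k) := by simp [mul_comm]
  rw [h, h.map_inv, e, smul_neg, ← mul_smul, ← T_add, add_neg_cancel, T_zero, one_smul,
    h.map_pow, h.map_pow, h x y, h y x, map_mul χ y x, mul_comm (χ y), map_mul χ x y, toAdd_mul,
    ← sub_eq_add_neg, ← smul_sub]
  congr 1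
  module

/-- Only additivity and compatibility with `t` matter; this generality covers maps that change the
coefficient ring. -/
theorem IsCrossed.map_semilinear {B : Type*} [CommRing B] {P : Type*} [AddCommGroup P]
    [Module B[T;T⁻¹] P] (h : IsCrossed A χ δ) (f : Q →+ P)
    (hf : ∀ n x, f ((T n : A[T;T⁻¹]) • x) = (T n : B[T;T⁻¹]) • f x) :
    IsCrossed B χ (fun x => f (δ x)) := fun x y => by
  simp only [h x y, map_add, hf]

theorem IsCrossed.map_linear {P : Type*} [AddCommGroup P] [Module A[T;T⁻¹] P]
    (h : IsCrossed A χ δ) (f : Q →ₗ[A[T;T⁻¹]] P) : IsCrossed A χ (fun x => f (δ x)) :=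
  h.map_semilinear (f : Q →+ P) fun _ _ => f.map_smul _ _

theorem IsCrossed.comp (h : IsCrossed A χ δ) {H : Type*} [Group H] (f : H →* G) :
    IsCrossed A (χ.comp f) (fun x => δ (f x)) := fun x y => by
  change δ (f (x * y)) = _
  rw [map_mul, h]; rfl

theorem IsCrossed.eq_of_freeGroup {V : Type*} {χ : FreeGroup V →* Multiplicative ℤ}
    {δ δ' : FreeGroup V → Q} (h : IsCrossed A χ δ) (h' : IsCrossed A χ δ')
    (hv : ∀ v, δ (FreeGroup.of v) = δ' (FreeGroup.of v)) (w : FreeGroup V) : δ w = δ' w := by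
  induction w using FreeGroup.induction_on with
  | C1 => rw [h.map_one, h'.map_one]
  | of v => exact hv v
  | inv_of v _ => rw [h.map_inv, h'.map_inv, hv]
  | mul x y hx hy => rw [h, h', hx, hy]

variable (A) in
/-- The affine permutation `y ↦ t ^ m y + x`. -/
def affinePerm (m : ℤ) (x : Q) : Equiv.Perm Q where
  toFun y := x + (T m : A[T;T⁻¹]) • y
  invFun y := (T (-m) : A[T;T⁻¹]) • (y - x)
  left_inv y := by
    beta_reduce
    rw [add_sub_cancel_left, ← mul_smul, ← T_add, neg_add_cancel, T_zero,
      one_smul]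
  right_inv y := by
    beta_reduce
    rw [← mul_smul, ← T_add, add_neg_cancel, T_zero, one_smul, add_sub_cancel]

variable (A) in
/-- The affine action of a free group on `Q` with prescribed values on the generators. -/
def affineHom {V : Type*} (m : V → ℤ) (x : V → Q) : FreeGroup V →* Equiv.Perm Q :=
  FreeGroup.lift fun v => affinePerm A (m v) (x v)

/-- The character of a free group with given values on the generators. -/
def freeCharacter {V : Type*} (m : V → ℤ) : FreeGroup V →* Multiplicative ℤ :=
  FreeGroup.lift fun v => Multiplicative.ofAdd (m v)

@[simp]
theorem freeCharacter_of {V : Type*} (m : V → ℤ) (v : V) :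
    freeCharacter m (FreeGroup.of v) = Multiplicative.ofAdd (m v) := by
  simp [freeCharacter]

variable (A) in
/-- The crossed homomorphism on a free group with prescribed values on the generators. -/
def foxDerivative {V : Type*} (m : V → ℤ) (x : V → Q) (w : FreeGroup V) : Q :=
  affineHom A m x w 0

/-- A crossed homomorphism is the translation part of an affine action with linear part `t^χ`; the
translation part is the image of `0`, and the crossed identity is multiplicativity of the action. -/
theorem affineHom_apply {V : Type*} (m : V → ℤ) (x : V → Q) (w : FreeGroup V) (y : Q) :
    affineHom A m x w y =
      foxDerivative A m x w + (T (freeCharacter m w).toAdd : A[T;T⁻¹]) • y := by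
  have hof : ∀ v y, affineHom A m x (FreeGroup.of v) y = x v + (T (m v) : A[T;T⁻¹]) • y :=
    fun v y => by simp [affineHom, affinePerm]
  induction w using FreeGroup.induction_on generalizing y with
  | C1 => simp [foxDerivative]
  | of v => simp [foxDerivative, hof]
  | inv_of v _ =>
    have key : ∀ z, affineHom A m x (FreeGroup.of v)⁻¹ z =
        (T (-m v) : A[T;T⁻¹]) • (z - x v) := fun z => by simp [affineHom, affinePerm]
    change affineHom A m x (FreeGroup.of v)⁻¹ y = affineHom A m x (FreeGroup.of v)⁻¹ 0 + _
    rw [key, key]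
    simp [sub_eq_neg_add]
  | mul a b ha hb =>
    simp only [foxDerivative] at ha hb ⊢
    simp only [map_mul, Equiv.Perm.mul_apply, toAdd_mul, T_add, mul_smul]
    rw [hb y, ha (_ + _), ha (affineHom A m x b 0), smul_add, add_assoc]

theorem isCrossed_foxDerivative {V : Type*} (m : V → ℤ) (x : V → Q) :
    IsCrossed A (freeCharacter m) (foxDerivative A m x) := fun a b => by
  rw [← affineHom_apply, foxDerivative, map_mul, Equiv.Perm.mul_apply, foxDerivative]

@[simp]
theorem foxDerivative_of {V : Type*} (m : V → ℤ) (x : V → Q) (v : V) :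
    foxDerivative A m x (FreeGroup.of v) = x v := by
  simp [foxDerivative, affineHom, affinePerm]

/-- A crossed homomorphism on a presented group exists as soon as its values on the generators
are compatible with the relators. -/
theorem exists_isCrossed_presentedGroup {V : Type*} {rels : Set (FreeGroup V)}
    (χ : PresentedGroup rels →* Multiplicative ℤ) (x : V → Q)
    (hx : ∀ r ∈ rels, foxDerivative A (fun v => (χ (PresentedGroup.of v)).toAdd) x r = 0) :
    ∃ δ : PresentedGroup rels → Q, IsCrossed A χ δ ∧
      ∀ v, δ (PresentedGroup.of v) = x v := by
  set m : V → ℤ := fun v => (χ (PresentedGroup.of v)).toAdd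
  have hχ : freeCharacter m = χ.comp (PresentedGroup.mk rels) := by
    ext v; simp [m]; rfl
  -- A relator acts without translation by `hx` and with linear part `t^0` because it is trivial in
  -- the group, so the affine action descends.
  have h1 : ∀ r ∈ rels, FreeGroup.lift (fun v => affinePerm A (m v) (x v)) r = 1 := by
    intro r hr
    ext y
    change affineHom A m x r y = y
    have : PresentedGroup.mk rels r = 1 := PresentedGroup.one_of_mem hr
    rw [affineHom_apply, hx r hr, hχ, MonoidHom.comp_apply, this]
    simp
  refine ⟨fun z => PresentedGroup.toGroup h1 z 0, fun a b => ?_, fun v => ?_⟩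
  · beta_reduce
    obtain ⟨a, rfl⟩ := PresentedGroup.mk_surjective rels a
    obtain ⟨b, rfl⟩ := PresentedGroup.mk_surjective rels b
    have key : ∀ w, PresentedGroup.toGroup h1 (PresentedGroup.mk rels w) 0 =
        foxDerivative A m x w := fun w => rfl
    rw [← map_mul, key, key, key, isCrossed_foxDerivative, hχ]
    rfl
  · simp [affinePerm]

end Crossed

/-! ### A presentation of `H_1(ker χ; K)` -/

namespace EvenLabeledGraph

open LaurentPolynomial

variable {V : Type u} [DecidableEq V] {Γ : EvenLabeledGraph V}

/-- The vector of Fox derivatives of the relator `(g_v g_w)^k (g_w g_v)^{-k}`. -/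
def edgeRelation {V : Type*} [DecidableEq V] (A : Type*) [CommRing A] (m : V → ℤ) (k : ℕ)
    (v w : V) : V → A[T;T⁻¹] :=
  (∑ i ∈ Finset.range k, (T (m v + m w) : A[T;T⁻¹]) ^ i) •
    ((1 - T (m w) : A[T;T⁻¹]) • Pi.single v 1 - (1 - T (m v) : A[T;T⁻¹]) • Pi.single w 1)

/-- The Fox derivatives of the relators of `A_Γ` and of a word `w`. -/
def foxRelations (A : Type*) [CommRing A] (χ : Γ.ArtinGroup →* Multiplicative ℤ)
    (w : FreeGroup V) : Set (V → A[T;T⁻¹]) :=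
  insert (foxDerivative A (weight χ) (fun v => Pi.single v 1) w)
    {r | ∃ (a b : V) (h : Γ.graph.Adj a b),
      r = edgeRelation A (weight χ) (Γ.halfLabel h) a b}

/-- The submodule generated by the Fox derivatives. -/
def foxSubmodule (A : Type*) [CommRing A] (χ : Γ.ArtinGroup →* Multiplicative ℤ)
    (w : FreeGroup V) : Submodule A[T;T⁻¹] (V → A[T;T⁻¹]) :=
  Submodule.span _ (foxRelations A χ w)

/-- The value on a relator is linear in the values on the two generators. It serves both directions
of the presentation: for Fox derivatives modulo the relations, and for the classes `[x g^{-χ(x)}]`.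
-/
theorem isCrossed_relator {A : Type*} [CommRing A] {χ : Γ.ArtinGroup →* Multiplicative ℤ}
    {G : Type*} [Group G] {Q : Type*} [AddCommGroup Q] [Module A[T;T⁻¹] Q]
    {χ' : G →* Multiplicative ℤ} {δ : G → Q} (hδ : IsCrossed A χ' δ) {a b : V} (x y : G)
    (hx : (χ' x).toAdd = weight χ a) (hy : (χ' y).toAdd = weight χ b) (k : ℕ)
    (f : (V → A[T;T⁻¹]) →ₗ[A[T;T⁻¹]] Q)
    (hfa : f (Pi.single a 1) = δ x) (hfb : f (Pi.single b 1) = δ y) :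
    δ ((x * y) ^ k * ((y * x) ^ k)⁻¹) = f (edgeRelation A (weight χ) k a b) := by
  rw [hδ.map_relator, edgeRelation, map_smul, map_sub, map_smul, map_smul, hfa, hfb, hx, hy]

omit [DecidableEq V] in
theorem freeCharacter_eq (χ : Γ.ArtinGroup →* Multiplicative ℤ) :
    freeCharacter (weight χ) = χ.comp (PresentedGroup.mk Γ.relators) := by
  ext v; simp [weight, gen]; rfl

theorem exists_isCrossed_quotient {A : Type*} [CommRing A]
    (χ : Γ.ArtinGroup →* Multiplicative ℤ) (w : FreeGroup V) :
    ∃ δ : Γ.ArtinGroup → (V → A[T;T⁻¹]) ⧸ foxSubmodule A χ w, IsCrossed A χ δ ∧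
      (∀ v, δ (Γ.gen v) = (foxSubmodule A χ w).mkQ (Pi.single v 1)) ∧
      δ (PresentedGroup.mk _ w) = 0 := by
  set N := foxSubmodule A χ w
  obtain ⟨δ, h1, h2⟩ := exists_isCrossed_presentedGroup (A := A) χ
    (fun v => N.mkQ (Pi.single v 1)) (by
      rintro r ⟨a, b, h, rfl⟩
      have hf := isCrossed_foxDerivative (A := A) (weight χ) (fun v => N.mkQ (Pi.single v 1))
      refine (isCrossed_relator (χ := χ) (a := a) (b := b) hf _ _ (by simp) (by simp) _ N.mkQ
        (by simp) (by simp)).trans ?_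
      rw [Submodule.mkQ_apply, Submodule.Quotient.mk_eq_zero]
      exact Submodule.subset_span (Or.inr ⟨a, b, h, rfl⟩))
  refine ⟨δ, h1, h2, ?_⟩
  have h3 := h1.comp (PresentedGroup.mk Γ.relators)
  rw [← freeCharacter_eq] at h3
  have h4 := (isCrossed_foxDerivative (A := A) (weight χ) (fun v => Pi.single v 1)).map_linear
    N.mkQ
  refine (h3.eq_of_freeGroup h4 (fun v => ?_) w).trans ?_
  · refine (h2 v).trans ?_
    simp
  · refine (Submodule.Quotient.mk_eq_zero _).2 (Submodule.subset_span (Or.inl rfl))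

variable (K : Type u) [Field K]

/-- The map `x ↦ [x g^{-χ(x)}]` is a crossed homomorphism. -/
theorem exists_isCrossed_kerClass {G : Type u} [Group G] (χ : G →* Multiplicative ℤ) (g : G)
    (hg : χ g = Multiplicative.ofAdd 1) :
    ∃ c : G → KerHomology K χ g 1, IsCrossed K χ c ∧ c g = 0 ∧
      ∀ n : χ.ker, c n = kerClass K χ g n 1 := by
  have hk : ∀ x : G, x * g ^ (-(χ x).toAdd) ∈ χ.ker := fun x => by
    rw [MonoidHom.mem_ker, map_mul, map_zpow, hg, ← ofAdd_zsmul]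
    simp
  have h1 : kerClass K χ g 1 1 = 0 := by
    have := kerClass_mul (K := K) (g := g) (1 : χ.ker) 1 1
    simpa using this
  refine ⟨fun x => kerClass K χ g ⟨_, hk x⟩ 1, fun x y => ?_, ?_, fun n => ?_⟩
  · beta_reduce
    rw [T_smul_kerClass, ← kerClass_mul]
    congr 2
    refine Subtype.ext ?_
    simp only [map_mul, toAdd_mul, Subgroup.coe_mul, MulAut.conjNormal_apply]
    group
  · convert h1
    simp [hg]
  · have : (⟨_, hk n⟩ : χ.ker) = n := Subtype.ext (by simp [show χ n = 1 from n.2])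
    exact congrArg (fun z => kerClass K χ g z 1) this

/-- `H_1(ker χ; K)` is the module presented by the Fox derivatives of the relators together with
those of a word that represents `g`. -/
theorem nonempty_kerHomology_equiv [Fintype V] (χ : Γ.ArtinGroup →* Multiplicative ℤ)
    (g : Γ.ArtinGroup) (hg : χ g = Multiplicative.ofAdd 1) (w : FreeGroup V)
    (hw : PresentedGroup.mk _ w = g) :
    Nonempty (KerHomology K χ g 1 ≃ₗ[K[T;T⁻¹]] (V → K[T;T⁻¹]) ⧸ foxSubmodule K χ w) := by
  set N := foxSubmodule K χ w with hN
  obtain ⟨δ, hδ, hδv, hδg⟩ := exists_isCrossed_quotient (A := K) χ w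
  rw [hw] at hδg
  obtain ⟨c, hc, hcg, hcn⟩ := exists_isCrossed_kerClass K χ g hg
  -- The vector `e_v` goes to the class of `g_v g^{-m_v}`.
  let ψ₀ : (V → K[T;T⁻¹]) →ₗ[K[T;T⁻¹]] KerHomology K χ g 1 :=
    Fintype.linearCombination K[T;T⁻¹] (fun v => c (Γ.gen v))
  have hψ₀ : ∀ v, ψ₀ (Pi.single v 1) = c (Γ.gen v) := fun v => by
    simp [ψ₀, Fintype.linearCombination_apply_single]
  have hc' := hc.comp (PresentedGroup.mk Γ.relators)
  have hNψ : N ≤ LinearMap.ker ψ₀ := by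
    refine Submodule.span_le.2 ?_
    rintro r (rfl | ⟨a, b, h, rfl⟩)
    · have h4 := (isCrossed_foxDerivative (A := K) (weight χ)
        (fun v => Pi.single v 1)).map_linear ψ₀
      rw [freeCharacter_eq] at h4
      refine (h4.eq_of_freeGroup hc' (fun v => ?_) w).trans ?_
      · refine Eq.trans ?_ (hψ₀ v)
        simp
      · rw [hw, hcg]
    · refine (isCrossed_relator hc (Γ.gen a) (Γ.gen b) rfl rfl _ ψ₀ (hψ₀ a)
        (hψ₀ b)).symm.trans ?_
      have : (Γ.gen a * Γ.gen b) ^ Γ.halfLabel h * ((Γ.gen b * Γ.gen a) ^ Γ.halfLabel h)⁻¹ = 1 :=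
        PresentedGroup.one_of_mem (rels := Γ.relators) ⟨a, b, h, rfl⟩
      rw [this, hc.map_one]
  let ψ := N.liftQ ψ₀ hNψ
  have hker : ∀ n : χ.ker, χ (n : Γ.ArtinGroup) = 1 := fun n => n.2
  -- In the other direction, `δ` is additive on `ker χ`, where the action is trivial, and so factors
  -- through homology.
  obtain ⟨θ₀, hθ₀⟩ := exists_kerHomology_lift (K := K) (χ := χ) (g := g)
    (Q := (V → K[T;T⁻¹]) ⧸ N)
    { toFun := fun n => Multiplicative.ofAdd (δ n)
      map_one' := by simp [hδ.map_one]
      map_mul' := fun a b => by simp [hδ (a : Γ.ArtinGroup) b, hker a] }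
  have hCQ : ∀ (a : K) (x : (V → K[T;T⁻¹]) ⧸ N), (C a : K[T;T⁻¹]) • x = a • x := fun a x => by
    rw [C_eq_algebraMap, algebraMap_smul]
  let θ : KerHomology K χ g 1 →ₗ[K[T;T⁻¹]] (V → K[T;T⁻¹]) ⧸ N :=
    { toFun := θ₀
      map_add' := map_add θ₀
      map_smul' := map_laurent_smul θ₀ C_smul_kerHomology hCQ (fun n x => by
        induction x using kerHomology_induction with
        | h0 => rw [smul_zero, map_zero, smul_zero]
        | hadd x y hx hy => rw [smul_add, map_add, map_add, hx, hy, smul_add]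
        | hc x a =>
          rw [T_smul_kerClass, hθ₀, hθ₀]
          have h5 := hδ.conj (g ^ n) x (hker x)
          rw [map_zpow, hg, ← ofAdd_zsmul] at h5
          simp only [MonoidHom.coe_mk, OneHom.coe_mk, toAdd_ofAdd, MulAut.conjNormal_apply]
          rw [h5, smul_comm]
          simp) }
  have hθ : ∀ n : χ.ker, θ (kerClass K χ g n 1) = δ n := fun n => by
    refine (hθ₀ n 1).trans ?_
    simp
  -- Both `c` and `δ` vanish on powers of `g`, so they do not change when `x` is replaced by `x
  -- g^{-χ(x)}`, which lies in the kernel.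
  have hθc : ∀ x, θ (c x) = δ x := by
    intro x
    have hk : x * g ^ (-(χ x).toAdd) ∈ χ.ker := by
      rw [MonoidHom.mem_ker, map_mul, map_zpow, hg, ← ofAdd_zsmul]
      simp
    have e1 := hcn ⟨_, hk⟩
    have e2 := hθ ⟨_, hk⟩
    rw [← e1] at e2
    rwa [hc x, hδ x, hc.zpow_eq_zero hcg, hδ.zpow_eq_zero hδg, smul_zero, smul_zero, add_zero,
      add_zero] at e2
  refine ⟨LinearEquiv.ofLinearMap θ ψ ?_ ?_⟩
  · refine Submodule.linearMap_qext _ (LinearMap.pi_ext' fun v => LinearMap.ext_ring ?_)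
    change θ (ψ₀ (Pi.single v 1)) = _
    rw [hψ₀, hθc, hδv]
    rfl
  · have hδc : ∀ x, ψ (δ x) = c x := by
      have h6 := (hδ.map_linear ψ).comp (PresentedGroup.mk Γ.relators)
      intro x
      obtain ⟨x, rfl⟩ := PresentedGroup.mk_surjective _ x
      refine h6.eq_of_freeGroup hc' (fun v => ?_) x
      change ψ (δ (Γ.gen v)) = c (Γ.gen v)
      rw [hδv, ← hψ₀]
      rfl
    ext x
    change ψ (θ₀ x) = x
    induction x using kerHomology_induction with
    | h0 => simp
    | hadd x y hx hy => rw [map_add, map_add, hx, hy]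
    | hc x a =>
      rw [hθ₀, ← hCQ, map_smul, C_smul_kerHomology]
      change a • ψ (δ x) = _
      rw [hδc, hcn, ← map_smul]
      simp

end EvenLabeledGraph

/-! ### Cyclotomic polynomials in the ring of Laurent polynomials -/

section Cyclotomic

open LaurentPolynomial

/-- In a localization of `F[X]` every ideal is the extension of its contraction, and the contraction
is principal. -/
theorem isPrincipalIdealRing_laurent (F : Type*) [Field F] : IsPrincipalIdealRing F[T;T⁻¹] where
  principal J := by
    obtain ⟨x, hx⟩ := IsPrincipalIdealRing.principal (Ideal.under (Polynomial F) J)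
    refine ⟨algebraMap (Polynomial F) F[T;T⁻¹] x, ?_⟩
    conv_lhs => rw [← IsLocalization.map_under (Submonoid.powers (Polynomial.X : Polynomial F))
      F[T;T⁻¹] J]
    rw [hx]
    exact (Ideal.map_span _ _).trans (by rw [Set.image_singleton])

/-- The `d`-th cyclotomic polynomial as a Laurent polynomial. -/
abbrev laurentCyclotomic (F : Type*) [Field F] (d : ℕ) : F[T;T⁻¹] :=
  Polynomial.toLaurent (Polynomial.cyclotomic d F)

variable (F : Type*) [Field F]

theorem laurentCyclotomic_one : laurentCyclotomic F 1 = T 1 - 1 := by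
  simp [laurentCyclotomic]

theorem laurentCyclotomic_ne_zero (d : ℕ) : laurentCyclotomic F d ≠ 0 :=
  Polynomial.toLaurent_ne_zero.2 (Polynomial.cyclotomic_ne_zero d F)

/-- Ring homomorphisms between coefficient fields, extended to Laurent polynomials. -/
abbrev laurentMap {A B : Type*} [CommRing A] [CommRing B] (f : A →+* B) :
    A[T;T⁻¹] →+* B[T;T⁻¹] :=
  AddMonoidAlgebra.mapRingHom ℤ f

theorem laurentMap_T {A B : Type*} [CommRing A] [CommRing B] (f : A →+* B) (n : ℤ) :
    laurentMap f (T n) = T n := by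
  rw [laurentMap, T, AddMonoidAlgebra.mapRingHom_single, map_one, T]

theorem laurentMap_toLaurent {A B : Type*} [CommRing A] [CommRing B] (f : A →+* B)
    (p : Polynomial A) :
    laurentMap f (Polynomial.toLaurent p) = Polynomial.toLaurent (p.map f) := by
  induction p using Polynomial.induction_on' with
  | add p q hp hq => simp only [map_add, Polynomial.map_add, hp, hq]
  | monomial n a =>
    rw [← Polynomial.C_mul_X_pow_eq_monomial]
    rw [Polynomial.map_mul, Polynomial.map_pow, Polynomial.map_C, Polynomial.map_X,
      Polynomial.toLaurent_C_mul_X_pow, Polynomial.toLaurent_C_mul_X_pow, map_mul, laurentMap_T,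
      ← single_eq_C, ← single_eq_C, laurentMap, AddMonoidAlgebra.mapRingHom_single]

theorem laurentMap_cyclotomic {E : Type*} [Field E] (f : F →+* E) (d : ℕ) :
    laurentMap f (laurentCyclotomic F d) = laurentCyclotomic E d := by
  rw [laurentMap_toLaurent, Polynomial.map_cyclotomic]

theorem prod_laurentCyclotomic {n : ℕ} (hn : 0 < n) :
    ∏ d ∈ n.divisors, laurentCyclotomic F d = T n - 1 := by
  rw [← map_prod, Polynomial.prod_cyclotomic_eq_X_pow_sub_one hn, map_sub, map_one,
    Polynomial.toLaurent_X_pow]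

theorem associated_T_sub_one {m : ℤ} (hm : m ≠ 0) :
    Associated (T m - 1 : F[T;T⁻¹]) (∏ d ∈ m.natAbs.divisors, laurentCyclotomic F d) := by
  rw [prod_laurentCyclotomic F (Int.natAbs_pos.2 hm)]
  rcases Int.natAbs_eq m with h | h
  · rw [← h]
  · have e : (T m.natAbs - 1 : F[T;T⁻¹]) = (T m - 1) * -(T m.natAbs) := by
      rw [sub_mul, mul_neg, ← T_add, show m + (m.natAbs : ℤ) = 0 by lia, T_zero]
      ring
    rw [e]
    exact (associated_mul_unit_right _ _ (isUnit_T _).neg)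

/-- The factor `Φ_1` is split off once and for all: this is why `t - 1` occurs only to the first
power in the annihilator. -/
theorem exists_T_sub_one_eq {m : ℤ} (hm : m ≠ 0) :
    ∃ u : F[T;T⁻¹], T m - 1 = (T 1 - 1) * u ∧
      Associated u (∏ d ∈ m.natAbs.divisors.erase 1, laurentCyclotomic F d) := by
  have h := associated_T_sub_one F hm
  rw [← Finset.mul_prod_erase _ _ (Nat.one_mem_divisors.2 (Int.natAbs_ne_zero.2 hm)),
    laurentCyclotomic_one] at h
  obtain ⟨c, hc⟩ := h.symm
  exact ⟨_, by rw [← hc, mul_assoc], associated_mul_unit_left _ _ c.isUnit⟩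

/-- For `m ≠ 0` the sum is `(t^{km} - 1) / (t^m - 1)`. For `m = 0` it is the constant `k`, a unit in
characteristic zero, and the index set of the product is empty. -/
theorem associated_geom_sum [CharZero F] (m : ℤ) {k : ℕ} (hk : 0 < k) :
    Associated (∑ i ∈ Finset.range k, (T m : F[T;T⁻¹]) ^ i)
      (∏ d ∈ (k * m.natAbs).divisors \ m.natAbs.divisors, laurentCyclotomic F d) := by
  rcases eq_or_ne m 0 with rfl | hm
  · have : IsUnit (k : F[T;T⁻¹]) := by
      have h : IsUnit (C (k : F) : F[T;T⁻¹]) :=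
        (IsUnit.mk0 (k : F) (Nat.cast_ne_zero.2 hk.ne')).map C
      simpa using h
    simpa using associated_one_iff_isUnit.2 this
  · have hn : m.natAbs ≠ 0 := Int.natAbs_ne_zero.2 hm
    have hsub : m.natAbs.divisors ⊆ (k * m.natAbs).divisors :=
      Nat.divisors_subset_of_dvd (mul_ne_zero hk.ne' hn) (dvd_mul_left _ _)
    have h1 := associated_T_sub_one F (m := k * m) (mul_ne_zero (by exact_mod_cast hk.ne') hm)
    rw [Int.natAbs_mul, Int.natAbs_natCast, ← Finset.prod_sdiff hsub, ← T_pow,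
      ← geom_sum_mul] at h1
    refine h1.of_mul_right (associated_T_sub_one F hm) ?_
    intro h0
    have := (associated_T_sub_one F hm)
    rw [h0] at this
    exact Finset.prod_ne_zero_iff.2 (fun d _ => laurentCyclotomic_ne_zero F d)
      (this.symm.eq_zero_iff.2 rfl)

/-- Evaluation of Laurent polynomials at a unit, after an extension of the coefficients. -/
theorem exists_ringHom_laurentCyclotomic [CharZero F] {d : ℕ} (hd : 0 < d) :
    ∃ f : F[T;T⁻¹] →+* AlgebraicClosure F, f (laurentCyclotomic F d) = 0 := by
  have : NeZero (d : AlgebraicClosure F) := ⟨by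
    have : CharZero (AlgebraicClosure F) := charZero_of_injective_algebraMap
      (algebraMap F (AlgebraicClosure F)).injective
    exact_mod_cast hd.ne'⟩
  obtain ⟨ζ, hζ⟩ := HasEnoughRootsOfUnity.exists_primitiveRoot (AlgebraicClosure F) d
  refine ⟨eval₂ (algebraMap F _) (hζ.isUnit hd.ne').unit, ?_⟩
  rw [eval₂_toLaurent, IsUnit.unit_spec, ← Polynomial.eval_map, Polynomial.map_cyclotomic]
  exact hζ.isRoot_cyclotomic hd

theorem not_isUnit_laurentCyclotomic [CharZero F] {d : ℕ} (hd : 0 < d) :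
    ¬ IsUnit (laurentCyclotomic F d) := fun h => by
  obtain ⟨f, hf⟩ := exists_ringHom_laurentCyclotomic F hd
  exact not_isUnit_zero (hf ▸ h.map f)

/-- A prime of `ℚ[X]` stays prime after inverting `X` unless it divides a power of `X`. If `Φ_d`
did, it would become a unit, but it vanishes at a root of unity. -/
theorem prime_laurentCyclotomic_rat {d : ℕ} (hd : 0 < d) : Prime (laurentCyclotomic ℚ d) := by
  have hp : Prime (Polynomial.cyclotomic d ℚ) :=
    (Polynomial.cyclotomic.irreducible_rat hd).prime
  rw [← Ideal.span_singleton_prime (laurentCyclotomic_ne_zero ℚ d)]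
  have h := IsLocalization.isPrime_of_isPrime_disjoint
    (Submonoid.powers (Polynomial.X : Polynomial ℚ)) ℚ[T;T⁻¹]
    (Ideal.span {Polynomial.cyclotomic d ℚ})
    ((Ideal.span_singleton_prime hp.ne_zero).2 hp) (by
      rw [Set.disjoint_left]
      rintro _ ⟨n, rfl⟩ hn
      have hdvd := Ideal.mem_span_singleton.1 hn
      have h2 : laurentCyclotomic ℚ d ∣ T n := by
        rw [← Polynomial.toLaurent_X_pow]; exact map_dvd _ hdvd
      exact not_isUnit_laurentCyclotomic ℚ hd (isUnit_of_dvd_unit h2 (isUnit_T _)))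
  rw [Ideal.map_span, Set.image_singleton] at h
  exact h

/-- The Bézout identity over `ℚ` is transported to `F`, where the `Φ_d` need not be irreducible. -/
theorem isCoprime_laurentCyclotomic [CharZero F] {d e : ℕ} (h : d ≠ e) :
    IsCoprime (laurentCyclotomic F d) (laurentCyclotomic F e) := by
  let := DivisionRing.toRatAlgebra (R := F)
  have h1 := (Polynomial.cyclotomic.isCoprime_rat h).map
    ((Polynomial.toLaurent).comp (Polynomial.mapRingHom (algebraMap ℚ F)))
  simpa [Polynomial.map_cyclotomic] using h1

end Cyclotomic

/-! ### The torsion of the module presented by a weighted graph -/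

section GraphModule

theorem smul_neg_mul_smul_sub {R M : Type*} [CommRing R] [AddCommGroup M] [Module R M]
    (q p a b : R) (x y : M) :
    q • (-(p * a) • x - -(p * b) • y) = (-p * q) • (a • x - b • y) := by
  module

variable {R : Type*} [CommRing R] [IsDomain R] {V : Type*} [Fintype V] [DecidableEq V]

/-- In the module generated by the vertices of a graph, with relations
`s_{ab} (u_b e_a - u_a e_b) = 0` for the edges and one further relation on which the functional `u`
takes the value one, every torsion element is killed by any common multiple of the
`s_{ab} u_a u_b` and the `u_v`. -/
theorem smul_mem_span_of_smul_mem_span (G : SimpleGraph V) (u : V → R) (hu : ∀ v, u v ≠ 0)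
    (s : ∀ a b, G.Adj a b → R) (b₀ : V → R) (hb₀ : ∑ v, b₀ v * u v = 1) (D : R)
    (hDu : ∀ v, u v ∣ D) (hD : ∀ a b h, s a b h * (u a * u b) ∣ D)
    (N : Submodule R (V → R))
    (hN : N = Submodule.span R (insert b₀ {r | ∃ a b h,
      r = s a b h • (u b • Pi.single a 1 - u a • Pi.single b 1)}))
    (x : V → R) (c : R) (hc : c ≠ 0) (hx : c • x ∈ N) : D • x ∈ N := by
  choose D' hD' using hDu
  set S : Set (V → R) := {r | ∃ a b h, r = s a b h • (u b • Pi.single a 1 - u a • Pi.single b 1)}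
  -- This is the class of `(D / u_v) e_v`. For an edge with `D = e s u_a u_b`, the difference of the
  -- vectors at `a` and `b` is `e` times the edge relation.
  let y : V → (V → R) ⧸ N := fun v => N.mkQ (D' v • Pi.single v 1)
  have hy : ∀ a b, G.Reachable a b → y a = y b := by
    rintro a b ⟨p⟩
    induction p with
    | nil => rfl
    | @cons a b c hab p ih =>
      rw [← ih]
      obtain ⟨e, he⟩ := hD a b hab
      have ha : D' a = e * (s a b hab * u b) := mul_left_cancel₀ (hu a) (by rw [← hD', he]; ring)
      have hb : D' b = e * (s a b hab * u a) := mul_left_cancel₀ (hu b) (by rw [← hD', he]; ring)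
      refine (Submodule.Quotient.eq N).2 ?_
      have : s a b hab • (u b • Pi.single a 1 - u a • Pi.single b 1) ∈ N := by
        rw [hN]
        exact Submodule.subset_span (Or.inr ⟨a, b, hab, rfl⟩)
      have h2 := N.smul_mem e this
      rw [ha, hb]
      convert h2 using 1
      module
  let ρ : V → V := fun v => (G.connectedComponentMk v).out
  have hρ : ∀ v, y (ρ v) = y v := fun v =>
    hy _ _ (SimpleGraph.ConnectedComponent.exact (Quot.out_eq (G.connectedComponentMk v)))
  -- `Λ` records the total of `x_v u_v` over each connected component, stored at its representative
  -- `ρ v`; it vanishes on all edge relations.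
  let Λ : (V → R) →ₗ[R] (V → R) :=
    Fintype.linearCombination R fun v => u v • (Pi.single (ρ v) 1 : V → R)
  have hΛ : ∀ v, Λ (Pi.single v 1) = u v • Pi.single (ρ v) 1 := fun v => by
    simp [Λ, Fintype.linearCombination_apply_single]
  let l : (V → R) →ₗ[R] R := Fintype.linearCombination R u
  have hl : ∀ v, l (Pi.single v 1) = u v := fun v => by
    simp [l, Fintype.linearCombination_apply_single]
  have hΛS : ∀ z ∈ Submodule.span R S, Λ z = 0 := by
    intro z hz
    have : Submodule.span R S ≤ LinearMap.ker Λ := by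
      refine Submodule.span_le.2 ?_
      rintro _ ⟨a, b, h, rfl⟩
      have e : ρ a = ρ b := by
        simp only [ρ, SimpleGraph.ConnectedComponent.sound h.reachable]
      simp [hΛ, e, smul_smul, mul_comm]
    exact this hz
  have hlS : ∀ z ∈ Submodule.span R S, l z = 0 := by
    intro z hz
    have : Submodule.span R S ≤ LinearMap.ker l := by
      refine Submodule.span_le.2 ?_
      rintro _ ⟨a, b, h, rfl⟩
      simp [hl, mul_comm]
    exact this hz
  have hb₀N : b₀ ∈ N := by rw [hN]; exact Submodule.subset_span (Or.inl rfl)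
  have hlb : l b₀ = 1 := by simpa [l, Fintype.linearCombination_apply] using hb₀
  -- Subtracting `l x • b₀`, which lies in `N`, reduces to `l x = 0`. Then `b₀` occurs with
  -- coefficient zero in `c • x`, so `c • Λ x = 0` and hence `Λ x = 0`.
  suffices h : ∀ x, l x = 0 → c • x ∈ N → D • x ∈ N by
    have h1 := h (x - l x • b₀) (by simp [hlb])
      (by rw [smul_sub]; exact N.sub_mem hx (N.smul_mem _ (N.smul_mem _ hb₀N)))
    rw [smul_sub] at h1
    simpa using N.add_mem h1 (N.smul_mem D (N.smul_mem (l x) hb₀N))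
  intro x hlx hx
  have hΛx : Λ x = 0 := by
    rw [hN, Submodule.mem_span_insert] at hx
    obtain ⟨r, z, hz, e⟩ := hx
    have hr : r = 0 := by
      have := congrArg l e
      simpa [hlx, hlb, hlS z hz] using this.symm
    have := congrArg Λ e
    rw [hr, zero_smul, zero_add, hΛS z hz, map_smul] at this
    exact (smul_eq_zero.1 this).resolve_left hc
  let Y : (V → R) →ₗ[R] (V → R) ⧸ N := Fintype.linearCombination R y
  -- Modulo `N`, `D e_v = u_v y_v = u_v y_{ρ v}`, so multiplication by `D` factors through `Λ`.
  have hYΛ : D • N.mkQ = Y ∘ₗ Λ := by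
    refine LinearMap.pi_ext' fun v => LinearMap.ext_ring ?_
    change D • N.mkQ (Pi.single v 1) = Y (Λ (Pi.single v 1))
    have hY : Y (Pi.single (ρ v) 1) = y (ρ v) := by
      simp [Y, Fintype.linearCombination_apply_single]
    rw [hΛ, map_smul, hY, hρ, hD' v, mul_smul, ← map_smul N.mkQ (D' v)]
  have h3 := LinearMap.congr_fun hYΛ x
  rw [LinearMap.comp_apply, hΛx, map_zero, LinearMap.smul_apply, ← map_smul] at h3
  exact (Submodule.Quotient.mk_eq_zero N).1 h3

end GraphModule

/-! ### Cyclotomic factors of the torsion annihilator -/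

namespace EvenLabeledGraph

open LaurentPolynomial

variable {V : Type u} [DecidableEq V] [Fintype V] {Γ : EvenLabeledGraph V}
  {χ : Γ.ArtinGroup →* Multiplicative ℤ}

omit [DecidableEq V] [Fintype V] in
theorem halfLabel_pos {v w : V} (h : Γ.graph.Adj v w) : 0 < Γ.halfLabel h := by
  have := Γ.one_lt_label ⟨s(v, w), h⟩
  unfold halfLabel
  lia

omit [DecidableEq V] in
-- Non-resonance makes `m_v` nonzero, and the condition `d ∤ m_e` excludes `m_e = 0`; so only
-- divisors of finitely many nonzero integers occur.
theorem finite_torsionOrders (hres : NonResonant χ) : (torsionOrders χ).Finite := by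
  have h1 : (⋃ v : V, {d : ℕ | (d : ℤ) ∣ weight χ v}).Finite := by
    refine Set.finite_iUnion fun v => ((weight χ v).natAbs.divisors.finite_toSet).subset ?_
    intro d hd
    simpa [hres v] using Int.natCast_dvd.1 hd
  have h2 : (⋃ v : V, ⋃ w : V, ⋃ h : Γ.graph.Adj v w,
      {d : ℕ | (d : ℤ) ∣ (Γ.halfLabel h : ℤ) * (weight χ v + weight χ w) ∧
          ¬ (d : ℤ) ∣ weight χ v + weight χ w}).Finite := by
    refine Set.finite_iUnion fun v => Set.finite_iUnion fun w => Set.finite_iUnion fun h =>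
      ((((Γ.halfLabel h : ℤ) * (weight χ v + weight χ w)).natAbs.divisors.finite_toSet)).subset ?_
    rintro d ⟨hd, hd'⟩
    have h0 : weight χ v + weight χ w ≠ 0 := fun h0 => hd' (h0 ▸ dvd_zero _)
    have := (halfLabel_pos h).ne'
    simpa [h0, this] using Int.natCast_dvd.1 hd
  refine (h1.union h2).subset ?_
  rintro d ⟨-, ⟨v, h⟩ | ⟨v, w, e, h⟩⟩
  · exact Or.inl (Set.mem_iUnion.2 ⟨v, h⟩)
  · exact Or.inr (Set.mem_iUnion.2 ⟨v, Set.mem_iUnion.2 ⟨w, Set.mem_iUnion.2 ⟨e, h⟩⟩⟩)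

variable (F : Type*) [Field F]

/-- The annihilator `(t - 1) ∏_d Φ_d²` of the torsion of `H_1(ker χ; F)`. -/
def torsionAnnihilator (hres : NonResonant χ) : F[T;T⁻¹] :=
  (T 1 - 1) * ∏ d ∈ (finite_torsionOrders hres).toFinset, laurentCyclotomic F d ^ 2

omit [DecidableEq V] [Fintype V] in
theorem prod_subset_eq_prod_ite {s t : Finset ℕ} (h : s ⊆ t) (f : ℕ → F[T;T⁻¹]) :
    ∏ d ∈ s, f d = ∏ d ∈ t, if d ∈ s then f d else 1 := by
  rw [Finset.prod_ite_mem, Finset.inter_eq_right.2 h]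

omit [DecidableEq V] in
theorem erase_divisors_subset (hres : NonResonant χ) (v : V) :
    (weight χ v).natAbs.divisors.erase 1 ⊆ (finite_torsionOrders hres).toFinset := by
  intro d hd
  rw [Finset.mem_erase, Nat.mem_divisors] at hd
  have h0 : d ≠ 0 := by rintro rfl; exact hd.2.2 (zero_dvd_iff.1 hd.2.1)
  rw [Set.Finite.mem_toFinset]
  exact ⟨by lia, Or.inl ⟨v, Int.natCast_dvd.2 hd.2.1⟩⟩

omit [DecidableEq V] in
theorem sdiff_divisors_subset (hres : NonResonant χ) {v w : V} (h : Γ.graph.Adj v w) :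
    (Γ.halfLabel h * (weight χ v + weight χ w).natAbs).divisors \
      (weight χ v + weight χ w).natAbs.divisors ⊆ (finite_torsionOrders hres).toFinset := by
  intro d hd
  rw [Finset.mem_sdiff, Nat.mem_divisors, Nat.mem_divisors] at hd
  obtain ⟨⟨h1, h2⟩, h3⟩ := hd
  have h4 : ¬ d ∣ (weight χ v + weight χ w).natAbs := fun h4 => h3 ⟨h4, right_ne_zero_of_mul h2⟩
  have h0 : d ≠ 0 := by rintro rfl; exact h2 (zero_dvd_iff.1 h1)
  have h5 : d ≠ 1 := by rintro rfl; exact h4 (one_dvd _)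
  rw [Set.Finite.mem_toFinset]
  refine ⟨by lia, Or.inr ⟨v, w, h, ?_, fun h6 => h4 (Int.natCast_dvd.1 h6)⟩⟩
  rw [Int.natCast_dvd, Int.natAbs_mul]
  exact h1

omit [DecidableEq V] in
/-- The divisibility by which cyclotomic factors occur at most twice. -/
theorem prod_mul_prod_dvd (hres : NonResonant χ) {v w : V} (h : Γ.graph.Adj v w) :
    (∏ d ∈ (Γ.halfLabel h * (weight χ v + weight χ w).natAbs).divisors \
      (weight χ v + weight χ w).natAbs.divisors, laurentCyclotomic F d) *
      ((∏ d ∈ (weight χ v).natAbs.divisors.erase 1, laurentCyclotomic F d) *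
        ∏ d ∈ (weight χ w).natAbs.divisors.erase 1, laurentCyclotomic F d) ∣
      ∏ d ∈ (finite_torsionOrders hres).toFinset, laurentCyclotomic F d ^ 2 := by
  rw [prod_subset_eq_prod_ite F (erase_divisors_subset hres v),
    prod_subset_eq_prod_ite F (erase_divisors_subset hres w),
    prod_subset_eq_prod_ite F (sdiff_divisors_subset hres h), ← Finset.prod_mul_distrib,
    ← Finset.prod_mul_distrib]
  refine Finset.prod_dvd_prod_of_dvd _ _ fun d _ => ?_
  -- A common divisor of `m_v` and `m_w` divides `m_e`, which the first set forbids; so `Φ_d`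
  -- appears in at most two of the three products.
  have key : ¬ (d ∈ (Γ.halfLabel h * (weight χ v + weight χ w).natAbs).divisors \
      (weight χ v + weight χ w).natAbs.divisors ∧ d ∈ (weight χ v).natAbs.divisors.erase 1 ∧
      d ∈ (weight χ w).natAbs.divisors.erase 1) := by
    rintro ⟨h1, h2, h3⟩
    rw [Finset.mem_sdiff, Nat.mem_divisors, Nat.mem_divisors] at h1
    rw [Finset.mem_erase, Nat.mem_divisors] at h2 h3
    refine h1.2 ⟨?_, right_ne_zero_of_mul h1.1.2⟩
    exact Int.natCast_dvd.1 (dvd_add (Int.natCast_dvd.2 h2.2.1) (Int.natCast_dvd.2 h3.2.1))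
  rw [pow_two]
  split_ifs <;> simp_all

/-- The fundamental formula of Fox calculus: both sides are crossed homomorphisms in the word and
agree on generators. -/
theorem sum_foxDerivative_mul {A : Type*} [CommRing A] (m : V → ℤ) (w : FreeGroup V) :
    ∑ v, foxDerivative A m (fun v => (Pi.single v 1 : V → A[T;T⁻¹])) w v * (T (m v) - 1) =
      T (freeCharacter m w).toAdd - 1 := by
  let l : (V → A[T;T⁻¹]) →ₗ[A[T;T⁻¹]] A[T;T⁻¹] :=
    Fintype.linearCombination A[T;T⁻¹] fun v => T (m v) - 1
  have h1 := (isCrossed_foxDerivative (A := A) m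
    (fun v => (Pi.single v 1 : V → A[T;T⁻¹]))).map_linear l
  have h2 : IsCrossed A (freeCharacter m)
      (fun w => (T (freeCharacter m w).toAdd - 1 : A[T;T⁻¹])) := fun x y => by
    simp only [map_mul, toAdd_mul, T_add, smul_eq_mul]
    ring
  have h3 := h1.eq_of_freeGroup h2 (fun v => by
    simp [l, Fintype.linearCombination_apply_single]) w
  simpa [l, Fintype.linearCombination_apply] using h3

omit [Fintype V] in
theorem edgeRelation_eq_of_factor {p : F[T;T⁻¹]} (m : V → ℤ) (u : V → F[T;T⁻¹])
    (hu : ∀ v, T (m v) - 1 = p * u v) (k : ℕ) (a b : V) :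
    edgeRelation F m k a b = (-p * ∑ i ∈ Finset.range k, (T (m a + m b) : F[T;T⁻¹]) ^ i) •
      (u b • Pi.single a 1 - u a • Pi.single b 1) := by
  rw [edgeRelation, ← neg_sub (T (m a)), ← neg_sub (T (m b)), hu, hu]
  exact smul_neg_mul_smul_sub _ _ _ _ _ _

theorem sum_foxDerivative_mul_factor (w : FreeGroup V)
    (hw : χ (PresentedGroup.mk _ w) = Multiplicative.ofAdd 1) (u : V → F[T;T⁻¹])
    (hu : ∀ v, T (weight χ v) - 1 = (T 1 - 1) * u v) :
    ∑ v, foxDerivative F (weight χ) (fun v => (Pi.single v 1 : V → F[T;T⁻¹])) w v * u v = 1 := by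
  have hp : (T 1 - 1 : F[T;T⁻¹]) ≠ 0 := by
    rw [← laurentCyclotomic_one]; exact laurentCyclotomic_ne_zero F 1
  have h := sum_foxDerivative_mul (A := F) (weight χ) w
  rw [freeCharacter_eq, MonoidHom.comp_apply, hw, toAdd_ofAdd] at h
  refine mul_left_cancel₀ hp ?_
  rw [mul_one, Finset.mul_sum]
  refine Eq.trans (Finset.sum_congr rfl fun v _ => ?_) h
  rw [hu]
  ring

/-- The torsion of `H_1(ker χ; F)` is killed by `(t - 1) ∏_d Φ_d²`. -/
theorem torsionAnnihilator_smul_mem [CharZero F] (hres : NonResonant χ) (w : FreeGroup V)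
    (hw : χ (PresentedGroup.mk _ w) = Multiplicative.ofAdd 1) (x : V → F[T;T⁻¹])
    (c : F[T;T⁻¹]) (hc : c ≠ 0) (hx : c • x ∈ foxSubmodule F χ w) :
    torsionAnnihilator F hres • x ∈ foxSubmodule F χ w := by
  choose u hu hu' using fun v => exists_T_sub_one_eq F (hres v)
  have hu0 : ∀ v, u v ≠ 0 := fun v h0 => by
    have h := hu' v
    rw [h0] at h
    exact Finset.prod_ne_zero_iff.2 (fun d _ => laurentCyclotomic_ne_zero F d)
      (h.symm.eq_zero_iff.2 rfl)
  refine smul_mem_span_of_smul_mem_span Γ.graph u hu0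
    (fun a b h => -(T 1 - 1) * ∑ i ∈ Finset.range (Γ.halfLabel h),
      (T (weight χ a + weight χ b) : F[T;T⁻¹]) ^ i)
    (foxDerivative F (weight χ) (fun v => Pi.single v 1) w) ?_ (torsionAnnihilator F hres) ?_ ?_ _ ?_
      x c hc hx
  · exact sum_foxDerivative_mul_factor F w hw u hu
  · intro v
    refine Dvd.dvd.mul_left ((hu' v).dvd.trans ?_) _
    rw [prod_subset_eq_prod_ite F (erase_divisors_subset hres v)]
    refine Finset.prod_dvd_prod_of_dvd _ _ fun d _ => ?_
    split_ifs
    · exact dvd_pow_self _ two_ne_zero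
    · exact one_dvd _
  · intro a b h
    rw [mul_assoc, neg_mul, neg_dvd]
    refine mul_dvd_mul_left _ (Dvd.dvd.trans ?_ (prod_mul_prod_dvd F hres h))
    exact ((associated_geom_sum F _ (halfLabel_pos h)).mul_mul
      ((hu' a).mul_mul (hu' b))).dvd
  · simp only [foxSubmodule, foxRelations, edgeRelation_eq_of_factor F (weight χ) u hu]

end EvenLabeledGraph

/-! ### Diagonalization of presentation matrices and change of rings -/

section Diagonalization

variable {V : Type*} [Fintype V] [DecidableEq V]

/-- Smith normal form: a submodule of `R^V` is spanned by multiples of the rows of an invertible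
matrix. -/
theorem exists_span_smul_rows {R : Type*} [CommRing R] [IsDomain R] [IsPrincipalIdealRing R]
    (N : Submodule R (V → R)) :
    ∃ (a : V → R) (P P' : Matrix V V R), P * P' = 1 ∧ P' * P = 1 ∧
      N = Submodule.span R (Set.range fun v => a v • P v) := by
  obtain ⟨n, snf⟩ := N.smithNormalForm (Pi.basisFun R V)
  -- Smith normal form indexes only a basis of `N`; the remaining vectors of the ambient basis
  -- receive the entry `0`.
  refine ⟨fun v => if h : ∃ i, snf.f i = v then snf.a h.choose else 0,
    ((Pi.basisFun R V).toMatrix snf.bM).transpose, (snf.bM.toMatrix (Pi.basisFun R V)).transpose,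
    ?_, ?_, ?_⟩
  · rw [← Matrix.transpose_mul, Module.Basis.toMatrix_mul_toMatrix_flip, Matrix.transpose_one]
  · rw [← Matrix.transpose_mul, Module.Basis.toMatrix_mul_toMatrix_flip, Matrix.transpose_one]
  · have hP : ∀ v, ((Pi.basisFun R V).toMatrix snf.bM).transpose v = snf.bM v := fun v => by
      ext w; simp [Module.Basis.toMatrix_apply]
    have hf : ∀ i, ∀ h : ∃ j, snf.f j = snf.f i, h.choose = i := fun i h =>
      snf.f.injective h.choose_spec
    have hN : N = Submodule.span R (Set.range fun i => (snf.bN i : V → R)) := by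
      have h := congrArg (Submodule.map N.subtype) snf.bN.span_eq
      rw [Submodule.map_top, Submodule.range_subtype, Submodule.map_span, ← Set.range_comp] at h
      exact h.symm
    conv_lhs => rw [hN]
    refine le_antisymm (Submodule.span_le.2 ?_) (Submodule.span_le.2 ?_)
    · rintro _ ⟨i, rfl⟩
      refine Submodule.subset_span ⟨snf.f i, ?_⟩
      have h : ∃ j, snf.f j = snf.f i := ⟨i, rfl⟩
      simp only [hP, dif_pos h, hf i h, snf.snf]
    · rintro _ ⟨v, rfl⟩
      simp only [hP]
      split_ifs with h
      · obtain ⟨i, rfl⟩ := h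
        refine Submodule.subset_span ⟨i, ?_⟩
        simp only [hf i ⟨i, rfl⟩, snf.snf]
      · simp

/-- A diagonalization of the span of a set of vectors is preserved under any change of rings. -/
theorem exists_equiv_span_image {R A : Type*} [CommRing R] [CommRing A] (φ : R →+* A)
    (S : Set (V → R)) (a : V → R) (P P' : Matrix V V R) (h : P * P' = 1) (h' : P' * P = 1)
    (hS : Submodule.span R S = Submodule.span R (Set.range fun v => a v • P v)) :
    ∃ L : (V → A) ≃ₗ[A] (V → A),
      Submodule.span A ((fun x v => φ (x v)) '' S) =
        (Submodule.span A (Set.range fun v => Pi.single v (φ (a v)))).map (L : (V → A) →ₗ[A] _) := by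
  have key : ∀ S₁ S₂ : Set (V → R), Submodule.span R S₁ ≤ Submodule.span R S₂ →
      Submodule.span A ((fun x v => φ (x v)) '' S₁) ≤
        Submodule.span A ((fun x v => φ (x v)) '' S₂) := by
    intro S₁ S₂ hle
    let f : (V → R) →ₛₗ[φ] (V → A) :=
      { toFun := fun x v => φ (x v)
        map_add' := fun x y => by ext; simp
        map_smul' := fun c x => by ext; simp }
    have h1 : Submodule.span R S₂ ≤ (Submodule.span A (f '' S₂)).comap f :=
      Submodule.span_le.2 fun x hx => Submodule.subset_span ⟨x, hx, rfl⟩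
    refine Submodule.span_le.2 ?_
    rintro _ ⟨x, hx, rfl⟩
    exact h1 (hle (Submodule.subset_span hx))
  have hmap : ∀ M M' : Matrix V V R, M * M' = 1 →
      (M'.map φ).transpose * (M.map φ).transpose = 1 := fun M M' hM => by
    rw [← Matrix.transpose_mul, ← Matrix.map_mul, hM, Matrix.map_one _ φ.map_zero φ.map_one,
      Matrix.transpose_one]
  -- The matrix is the transpose of `φ(P)`, so that `e_v` is sent to the image of the row `P v`;
  -- applying `φ` to `P'` provides the inverse.
  refine ⟨Matrix.toLin'OfInv (hmap _ _ h) (hmap _ _ h'), ?_⟩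
  rw [Submodule.map_span, ← Set.range_comp]
  refine (le_antisymm (key _ _ hS.le) (key _ _ hS.ge)).trans ?_
  rw [← Set.range_comp]
  congr 2
  ext v w
  simp [Matrix.toLin'OfInv, mul_comm]

end Diagonalization

/-! ### Decompositions into cyclic modules -/

section DirectSums

variable {R : Type*} [CommRing R] {ι : Type*}

/-- A product of direct sums is the direct sum of the products. -/
theorem nonempty_directSum_prod_equiv [DecidableEq ι] (A B : ι → Type*)
    [∀ i, AddCommGroup (A i)] [∀ i, Module R (A i)] [∀ i, AddCommGroup (B i)]
    [∀ i, Module R (B i)] :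
    Nonempty (((⨁ i, A i) × (⨁ i, B i)) ≃ₗ[R] ⨁ i, (A i × B i)) := by
  refine ⟨LinearEquiv.ofLinearMap
    (LinearMap.coprod (DirectSum.lmap fun i => LinearMap.inl R (A i) (B i))
      (DirectSum.lmap fun i => LinearMap.inr R (A i) (B i)))
    (LinearMap.prod (DirectSum.lmap fun i => LinearMap.fst R (A i) (B i))
      (DirectSum.lmap fun i => LinearMap.snd R (A i) (B i))) ?_ ?_⟩
  · refine DirectSum.linearMap_ext R fun i => LinearMap.ext fun x => ?_
    simp [← map_add]
  · refine LinearMap.prod_ext ?_ ?_ <;>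
      refine DirectSum.linearMap_ext R fun i => LinearMap.ext fun x => ?_ <;>
      simp

/-- A direct sum with at most one nonzero summand. -/
theorem nonempty_directSum_equiv_of_subsingleton [DecidableEq ι] (A : ι → Type*)
    [∀ i, AddCommGroup (A i)] [∀ i, Module R (A i)] (i₀ : ι)
    (h : ∀ i, i ≠ i₀ → Subsingleton (A i)) : Nonempty ((⨁ i, A i) ≃ₗ[R] A i₀) := by
  refine ⟨LinearEquiv.ofLinearMap (DirectSum.component R ι A i₀) (DirectSum.lof R ι A i₀) ?_ ?_⟩
  · ext x
    simp
  · refine DirectSum.linearMap_ext R fun i => LinearMap.ext fun x => ?_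
    rcases eq_or_ne i i₀ with rfl | hi
    · simp [DirectSum.component.lof_self]
    · have := h i hi
      rw [Subsingleton.elim x 0]
      simp

theorem subsingleton_directSum (A : ι → Type*) [∀ i, AddCommGroup (A i)]
    (h : ∀ i, Subsingleton (A i)) : Subsingleton (⨁ i, A i) :=
  ⟨fun x y => DFinsupp.ext fun i => Subsingleton.elim (x i) (y i)⟩

theorem nonempty_fin_add_equiv (M : Type*) [AddCommGroup M] [Module R M] (m n : ℕ) :
    Nonempty (((Fin m → M) × (Fin n → M)) ≃ₗ[R] (Fin (m + n) → M)) :=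
  ⟨(LinearEquiv.sumArrowLequivProdArrow (Fin m) (Fin n) R M).symm ≪≫ₗ
    LinearEquiv.funCongrLeft R M finSumFinEquiv.symm⟩

theorem nonempty_fin_equiv_of_eq_one (M : Type*) [AddCommGroup M] [Module R M] {n : ℕ}
    (h : n = 1) : Nonempty ((Fin n → M) ≃ₗ[R] M) := by
  subst h
  exact ⟨LinearEquiv.funUnique (Fin 1) R M⟩

theorem nonempty_prod_equiv_left (A B : Type*) [AddCommMonoid A] [Module R A] [AddCommMonoid B]
    [Module R B] [Subsingleton B] : Nonempty ((A × B) ≃ₗ[R] A) :=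
  let _ : Unique B := uniqueOfSubsingleton 0
  ⟨LinearEquiv.prodUnique⟩

theorem nonempty_prod_equiv_right (A B : Type*) [AddCommMonoid A] [Module R A] [AddCommMonoid B]
    [Module R B] [Subsingleton A] : Nonempty ((A × B) ≃ₗ[R] B) :=
  let _ : Unique A := uniqueOfSubsingleton 0
  ⟨LinearEquiv.uniqueProd⟩

/-- The Chinese remainder theorem for two coprime elements, as an isomorphism of modules. -/
theorem nonempty_quotient_mul_equiv {x y : R} (h : IsCoprime x y) :
    Nonempty ((R ⧸ Ideal.span {x * y}) ≃ₗ[R] (R ⧸ Ideal.span {x}) × (R ⧸ Ideal.span {y})) := by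
  rw [← Ideal.span_singleton_mul_span_singleton]
  let e := Ideal.quotientMulEquivQuotientProd (Ideal.span {x}) (Ideal.span {y})
    ((Ideal.isCoprime_span_singleton_iff x y).2 h)
  refine ⟨{ e with map_smul' := fun r z => ?_ }⟩
  obtain ⟨z, rfl⟩ := Ideal.Quotient.mk_surjective z
  rfl

end DirectSums

/-! ### Modules with prescribed free and `(t - 1)` ranks -/

section Decomposition

open LaurentPolynomial

variable (K : Type u) [Field K] (S : Set ℕ)

/-- The module with free rank `r`, with `s` summands `K[t^{±1}] / (t - 1)`, and with `n d j`
summands `K[t^{±1}] / (Φ_d ^ j)`. -/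
abbrev DecomposedModule (r s : ℕ) (n : S → ℕ+ → ℕ) : Type u :=
  (Fin r → K[T;T⁻¹]) × (Fin s → TrivialSummand K) ×
    ⨁ d : S, ⨁ j : ℕ+, (Fin (n d j) → CyclotomicSummand K d j)

/-- The modules with a decomposition with given numbers of summands `K[t^{±1}]` and
`K[t^{±1}] / (t - 1)`. -/
def HasDecomposition (M : Type*) [AddCommGroup M] [Module K[T;T⁻¹] M] (r s : ℕ) : Prop :=
  ∃ n : S → ℕ+ → ℕ, Nonempty (M ≃ₗ[K[T;T⁻¹]] DecomposedModule K S r s n)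

variable {K S} {M N : Type*} [AddCommGroup M] [Module K[T;T⁻¹] M] [AddCommGroup N]
  [Module K[T;T⁻¹] N] {r s r' s' : ℕ}

theorem HasDecomposition.of_equiv (h : HasDecomposition K S M r s) (e : N ≃ₗ[K[T;T⁻¹]] M) :
    HasDecomposition K S N r s := by
  obtain ⟨n, ⟨f⟩⟩ := h
  exact ⟨n, ⟨e.trans f⟩⟩

theorem HasDecomposition.prod (h : HasDecomposition K S M r s)
    (h' : HasDecomposition K S N r' s') : HasDecomposition K S (M × N) (r + r') (s + s') := by
  classical
  obtain ⟨n, ⟨f⟩⟩ := h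
  obtain ⟨n', ⟨f'⟩⟩ := h'
  obtain ⟨e1⟩ := nonempty_fin_add_equiv (R := K[T;T⁻¹]) K[T;T⁻¹] r r'
  obtain ⟨e2⟩ := nonempty_fin_add_equiv (R := K[T;T⁻¹]) (TrivialSummand K) s s'
  obtain ⟨e3⟩ := nonempty_directSum_prod_equiv (R := K[T;T⁻¹])
    (fun d : S => ⨁ j : ℕ+, (Fin (n d j) → CyclotomicSummand K d j))
    (fun d : S => ⨁ j : ℕ+, (Fin (n' d j) → CyclotomicSummand K d j))
  have e4 := fun d : S => (nonempty_directSum_prod_equiv (R := K[T;T⁻¹])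
    (fun j : ℕ+ => (Fin (n d j) → CyclotomicSummand K d j))
    (fun j : ℕ+ => (Fin (n' d j) → CyclotomicSummand K d j))).some
  have e5 := fun (d : S) (j : ℕ+) =>
    (nonempty_fin_add_equiv (R := K[T;T⁻¹]) (CyclotomicSummand K d j) (n d j) (n' d j)).some
  have e6 := e3.trans (DFinsupp.mapRange.linearEquiv fun d =>
    (e4 d).trans (DFinsupp.mapRange.linearEquiv fun j => e5 d j))
  have e7 := (LinearEquiv.prodProdProdComm K[T;T⁻¹] _ _ _ _).trans (e2.prodCongr e6)
  have e8 := (LinearEquiv.prodProdProdComm K[T;T⁻¹] _ _ _ _).trans (e1.prodCongr e7)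
  exact ⟨fun d j => n d j + n' d j, ⟨(f.prodCongr f').trans e8⟩⟩

theorem subsingleton_cyclotomicPart {n : S → ℕ+ → ℕ} (hn : ∀ d j, n d j = 0) :
    Subsingleton (⨁ d : S, ⨁ j : ℕ+, (Fin (n d j) → CyclotomicSummand K d j)) :=
  subsingleton_directSum _ fun d => subsingleton_directSum _ fun j => by
    rw [hn]; infer_instance

theorem HasDecomposition.of_subsingleton [Subsingleton M] : HasDecomposition K S M 0 0 := by
  have := subsingleton_cyclotomicPart (K := K) (S := S) (n := fun _ _ => 0) fun _ _ => rfl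
  exact ⟨fun _ _ => 0, ⟨LinearEquiv.ofSubsingleton _ _⟩⟩

theorem hasDecomposition_free : HasDecomposition K S K[T;T⁻¹] 1 0 := by
  have := subsingleton_cyclotomicPart (K := K) (S := S) (n := fun _ _ => 0) fun _ _ => rfl
  obtain ⟨e⟩ := nonempty_prod_equiv_left (R := K[T;T⁻¹]) (Fin 1 → K[T;T⁻¹])
    ((Fin 0 → TrivialSummand K) ×
      ⨁ d : S, ⨁ j : ℕ+, (Fin ((fun _ _ => 0 : S → ℕ+ → ℕ) d j) → CyclotomicSummand K d j))
  exact ⟨fun _ _ => 0, ⟨((e.trans (LinearEquiv.funUnique (Fin 1) _ _))).symm⟩⟩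

theorem hasDecomposition_trivialSummand : HasDecomposition K S (TrivialSummand K) 0 1 := by
  have := subsingleton_cyclotomicPart (K := K) (S := S) (n := fun _ _ => 0) fun _ _ => rfl
  obtain ⟨e⟩ := nonempty_prod_equiv_left (R := K[T;T⁻¹]) (Fin 1 → TrivialSummand K)
    (⨁ d : S, ⨁ j : ℕ+, (Fin ((fun _ _ => 0 : S → ℕ+ → ℕ) d j) → CyclotomicSummand K d j))
  obtain ⟨e'⟩ := nonempty_prod_equiv_right (R := K[T;T⁻¹]) (Fin 0 → K[T;T⁻¹])
    ((Fin 1 → TrivialSummand K) ×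
      ⨁ d : S, ⨁ j : ℕ+, (Fin ((fun _ _ => 0 : S → ℕ+ → ℕ) d j) → CyclotomicSummand K d j))
  exact ⟨fun _ _ => 0, ⟨((e'.trans e).trans (LinearEquiv.funUnique (Fin 1) _ _)).symm⟩⟩

theorem hasDecomposition_cyclotomicSummand {d : ℕ} (hd : d ∈ S) {j : ℕ} (hj : 0 < j) :
    HasDecomposition K S (CyclotomicSummand K d j) 0 0 := by
  classical
  let n : S → ℕ+ → ℕ := fun d' j' => if (d' : ℕ) = d ∧ (j' : ℕ) = j then 1 else 0
  obtain ⟨e1⟩ := nonempty_directSum_equiv_of_subsingleton (R := K[T;T⁻¹])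
    (fun d : S => ⨁ j : ℕ+, (Fin (n d j) → CyclotomicSummand K d j)) ⟨d, hd⟩ (fun d' h =>
      subsingleton_directSum _ fun j' => by
        have : n d' j' = 0 := if_neg fun h' => h (Subtype.ext h'.1)
        rw [this]; infer_instance)
  obtain ⟨e2⟩ := nonempty_directSum_equiv_of_subsingleton (R := K[T;T⁻¹])
    (fun j' : ℕ+ => (Fin (n ⟨d, hd⟩ j') → CyclotomicSummand K d j')) ⟨j, hj⟩ (fun j' h => by
        have : n ⟨d, hd⟩ j' = 0 := if_neg fun h' => h (PNat.eq h'.2)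
        rw [this]; infer_instance)
  obtain ⟨e3⟩ := nonempty_fin_equiv_of_eq_one (R := K[T;T⁻¹]) (CyclotomicSummand K d j)
    (n := n ⟨d, hd⟩ ⟨j, hj⟩) (if_pos ⟨rfl, rfl⟩)
  obtain ⟨e4⟩ := nonempty_prod_equiv_right (R := K[T;T⁻¹]) (Fin 0 → TrivialSummand K)
    (⨁ d : S, ⨁ j : ℕ+, (Fin (n d j) → CyclotomicSummand K d j))
  obtain ⟨e5⟩ := nonempty_prod_equiv_right (R := K[T;T⁻¹]) (Fin 0 → K[T;T⁻¹])
    ((Fin 0 → TrivialSummand K) × ⨁ d : S, ⨁ j : ℕ+, (Fin (n d j) → CyclotomicSummand K d j))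
  exact ⟨n, ⟨(((e5.trans e4).trans (e1.trans e2)).trans e3).symm⟩⟩

theorem hasDecomposition_pi {ι : Type u} [Fintype ι] (M : ι → Type u) [∀ i, AddCommGroup (M i)]
    [∀ i, Module K[T;T⁻¹] (M i)] (r s : ι → ℕ) (h : ∀ i, HasDecomposition K S (M i) (r i) (s i)) :
    HasDecomposition K S (∀ i, M i) (∑ i, r i) (∑ i, s i) := by
  revert M r s
  refine Fintype.induction_empty_option (P := fun ι _ => ∀ (M : ι → Type u)
    [∀ i, AddCommGroup (M i)] [∀ i, Module K[T;T⁻¹] (M i)] (r s : ι → ℕ),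
    (∀ i, HasDecomposition K S (M i) (r i) (s i)) →
    HasDecomposition K S (∀ i, M i) (∑ i, r i) (∑ i, s i)) ?_ ?_ ?_ ι
  · intro α β _ e ih M _ _ r s h
    let := Fintype.ofEquiv β e.symm
    have := ih (fun i => M (e i)) (fun i => r (e i)) (fun i => s (e i)) fun i => h (e i)
    rw [← Equiv.sum_comp e, ← Equiv.sum_comp e]
    exact this.of_equiv (LinearEquiv.piCongrLeft K[T;T⁻¹] M e).symm
  · intro M _ _ r s h
    exact HasDecomposition.of_subsingleton
  · intro α _ ih M _ _ r s h
    have := (h none).prod (ih (fun i => M (some i)) (fun i => r (some i)) (fun i => s (some i))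
      fun i => h (some i))
    rw [Fintype.sum_option, Fintype.sum_option]
    exact this.of_equiv (LinearEquiv.piOptionEquivProd K[T;T⁻¹])

theorem hasDecomposition_quotient_congr {x y : K[T;T⁻¹]} (h : Associated x y)
    (hx : HasDecomposition K S (K[T;T⁻¹] ⧸ Ideal.span {x}) r s) :
    HasDecomposition K S (K[T;T⁻¹] ⧸ Ideal.span {y}) r s :=
  hx.of_equiv (Submodule.quotEquivOfEq _ _ (Ideal.span_singleton_eq_span_singleton.2 h.symm))

variable [CharZero K]

/-- The Chinese remainder theorem, one factor at a time. Coprimality is enough, so `Φ_d` may be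
reducible over `K`; factors with exponent zero contribute the zero module. -/
theorem hasDecomposition_quotient_prod (t : Finset ℕ) (ht : ∀ d ∈ t, d ∈ S) (j : ℕ → ℕ) :
    HasDecomposition K S
      (K[T;T⁻¹] ⧸ Ideal.span {∏ d ∈ t, laurentCyclotomic K d ^ j d}) 0 0 := by
  classical
  induction t using Finset.induction_on with
  | empty =>
    have : Subsingleton (K[T;T⁻¹] ⧸ Ideal.span {∏ d ∈ ∅, laurentCyclotomic K d ^ j d}) := by
      rw [Finset.prod_empty, Ideal.span_singleton_one]
      exact Ideal.Quotient.subsingleton_iff.2 rfl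
    exact HasDecomposition.of_subsingleton
  | insert d t hdt ih =>
    rw [Finset.prod_insert hdt]
    have hco : IsCoprime (laurentCyclotomic K d ^ j d)
        (∏ d ∈ t, laurentCyclotomic K d ^ j d) :=
      IsCoprime.prod_right fun e he => (isCoprime_laurentCyclotomic K (by
        rintro rfl; exact hdt he)).pow
    obtain ⟨e⟩ := nonempty_quotient_mul_equiv hco
    have h1 := ih fun d hd => ht d (Finset.mem_insert_of_mem hd)
    have h2 : HasDecomposition K S (K[T;T⁻¹] ⧸ Ideal.span {laurentCyclotomic K d ^ j d}) 0 0 := by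
      rcases Nat.eq_zero_or_pos (j d) with h0 | h0
      · have : Subsingleton (K[T;T⁻¹] ⧸ Ideal.span {laurentCyclotomic K d ^ j d}) := by
          rw [h0, pow_zero, Ideal.span_singleton_one]
          exact Ideal.Quotient.subsingleton_iff.2 rfl
        exact HasDecomposition.of_subsingleton
      · exact hasDecomposition_cyclotomicSummand (ht d (Finset.mem_insert_self _ _)) h0
    exact (h2.prod h1).of_equiv e

theorem hasDecomposition_quotient_mul_prod (t : Finset ℕ) (ht : ∀ d ∈ t, d ∈ S)
    (ht1 : 1 ∉ t) (j : ℕ → ℕ) {ε : ℕ} (hε : ε ≤ 1) :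
    HasDecomposition K S (K[T;T⁻¹] ⧸
      Ideal.span {(T 1 - 1) ^ ε * ∏ d ∈ t, laurentCyclotomic K d ^ j d}) 0 ε := by
  rcases Nat.le_one_iff_eq_zero_or_eq_one.1 hε with rfl | rfl
  · rw [pow_zero, one_mul]
    exact hasDecomposition_quotient_prod t ht j
  · rw [pow_one]
    have hco : IsCoprime (T 1 - 1 : K[T;T⁻¹]) (∏ d ∈ t, laurentCyclotomic K d ^ j d) := by
      rw [← laurentCyclotomic_one]
      exact IsCoprime.prod_right fun e he => (isCoprime_laurentCyclotomic K (by
        rintro rfl; exact ht1 he)).pow_right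
    obtain ⟨e⟩ := nonempty_quotient_mul_equiv hco
    exact (hasDecomposition_trivialSummand.prod (hasDecomposition_quotient_prod t ht j)).of_equiv e

end Decomposition

/-! ### Invariants of diagonal presentations -/

section DiagonalInvariants

variable {V : Type*} [Fintype V] [DecidableEq V]

theorem span_range_single_eq_pi {A : Type*} [CommRing A] (c : V → A) :
    Submodule.span A (Set.range fun v => (Pi.single v (c v) : V → A)) =
      Submodule.pi Set.univ fun v => Ideal.span {c v} := by
  refine le_antisymm (Submodule.span_le.2 ?_) fun x hx => ?_
  · rintro _ ⟨v, rfl⟩ w -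
    rcases eq_or_ne w v with rfl | h
    · simp
    · simp [h]
  · choose y hy using fun v => Ideal.mem_span_singleton'.1 (hx v (Set.mem_univ v))
    have e : x = ∑ v, y v • (Pi.single v (c v) : V → A) := by
      ext w
      simp [Finset.sum_apply, Pi.single_apply, hy]
    rw [e]
    exact Submodule.sum_mem _ fun v _ => Submodule.smul_mem _ _ (Submodule.subset_span ⟨v, rfl⟩)

theorem nonempty_quotient_equiv_pi {A : Type*} [CommRing A] (c : V → A) (N : Submodule A (V → A))
    (L : (V → A) ≃ₗ[A] (V → A)) (hN : N = (Submodule.span A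
      (Set.range fun v => (Pi.single v (c v) : V → A))).map (L : (V → A) →ₗ[A] _)) :
    Nonempty (((V → A) ⧸ N) ≃ₗ[A] ∀ v, A ⧸ Ideal.span {c v}) := by
  rw [span_range_single_eq_pi] at hN
  exact ⟨(Submodule.Quotient.equiv _ _ L hN.symm).symm.trans
    (Submodule.quotientPi fun v => Ideal.span {c v})⟩

theorem finrank_of_eq_map_span_single {K : Type*} [Field K] (c : V → K) (N : Submodule K (V → K))
    (L : (V → K) ≃ₗ[K] (V → K)) (hN : N = (Submodule.span K
      (Set.range fun v => (Pi.single v (c v) : V → K))).map (L : (V → K) →ₗ[K] _)) :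
    Module.finrank K N = Nat.card {v // c v ≠ 0} := by
  classical
  have h : (Matrix.diagonal c).col = fun v => (Pi.single v (c v) : V → K) := by
    ext v w
    rcases eq_or_ne w v with rfl | h
    · simp [Matrix.col]
    · simp [Matrix.col, h]
  rw [hN, LinearEquiv.finrank_map_eq, ← h, ← Matrix.rank_eq_finrank_span_cols,
    Matrix.rank_diagonal, Nat.card_eq_fintype_card]

/-- If `D` kills the torsion of the quotient by a diagonalized submodule, then the nonzero
diagonal entries divide `D`. -/
theorem dvd_of_smul_mem_span_rows {R : Type*} [CommRing R] {a : V → R} {P P' : Matrix V V R}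
    (h : P * P' = 1) {N : Submodule R (V → R)}
    (hN : N = Submodule.span R (Set.range fun v => a v • P v)) {D : R}
    (hD : ∀ (x : V → R) (c : R), c ≠ 0 → c • x ∈ N → D • x ∈ N) (v : V) (hv : a v ≠ 0) :
    a v ∣ D := by
  -- The `v`-th coordinate with respect to the rows of `P`. It maps `N` into `(a v)` and `D • P v`
  -- to `D`.
  let l : (V → R) →ₗ[R] R := LinearMap.proj v ∘ₗ Matrix.toLin' P'.transpose
  have hl : ∀ w, l (P w) = (1 : Matrix V V R) w v := fun w => by
    rw [← h, Matrix.mul_apply]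
    simp [l, Matrix.mulVec, dotProduct, mul_comm]
  have key : N ≤ Submodule.comap l (Ideal.span {a v}) := by
    rw [hN]
    refine Submodule.span_le.2 ?_
    rintro _ ⟨w, rfl⟩
    change l (a w • P w) ∈ Ideal.span {a v}
    rw [map_smul, hl]
    rcases eq_or_ne w v with rfl | hw
    · simp
    · simp [Matrix.one_apply_ne hw]
  have h1 : D • P v ∈ N :=
    hD _ (a v) hv (by rw [hN]; exact Submodule.subset_span ⟨v, rfl⟩)
  have h2 : l (D • P v) ∈ Ideal.span {a v} := key h1
  rw [map_smul, hl] at h2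
  simpa [Ideal.mem_span_singleton] using h2

end DiagonalInvariants

/-! ### Divisors of the annihilator, and cyclotomic values at `t = 1` and `t = 2` -/

section DivisorForm

open LaurentPolynomial

/-- The divisors of `(t - 1) ∏_d Φ_d²` over the rational numbers. -/
theorem exists_associated_of_dvd (t : Finset ℕ) (ht : ∀ d ∈ t, 0 < d) {a : ℚ[T;T⁻¹]}
    (ha : a ∣ (T 1 - 1) * ∏ d ∈ t, laurentCyclotomic ℚ d ^ 2) :
    ∃ (ε : ℕ) (j : ℕ → ℕ), ε ≤ 1 ∧
      Associated a ((T 1 - 1) ^ ε * ∏ d ∈ t, laurentCyclotomic ℚ d ^ j d) := by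
  classical
  have := isPrincipalIdealRing_laurent ℚ
  have key : ∀ t : Finset ℕ, (∀ d ∈ t, 0 < d) → ∀ a : ℚ[T;T⁻¹],
      a ∣ ∏ d ∈ t, laurentCyclotomic ℚ d ^ 2 →
      ∃ j : ℕ → ℕ, Associated a (∏ d ∈ t, laurentCyclotomic ℚ d ^ j d) := by
    intro t
    induction t using Finset.induction_on with
    | empty =>
      intro _ a ha
      exact ⟨0, by simpa [associated_one_iff_isUnit, isUnit_iff_dvd_one] using ha⟩
    | insert d t hd ih =>
      intro ht a ha
      rw [Finset.prod_insert hd] at ha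
      obtain ⟨b, c, hb, hc, rfl⟩ := exists_dvd_and_dvd_of_dvd_mul ha
      obtain ⟨i, -, hi⟩ := (dvd_prime_pow
        (prime_laurentCyclotomic_rat (ht d (Finset.mem_insert_self _ _))) 2).1 hb
      obtain ⟨j, hj⟩ := ih (fun e he => ht e (Finset.mem_insert_of_mem he)) c hc
      refine ⟨Function.update j d i, ?_⟩
      rw [Finset.prod_insert hd, Function.update_self]
      refine hi.mul_mul (hj.trans (Associated.of_eq ?_))
      refine Finset.prod_congr rfl fun e he => ?_
      rw [Function.update_of_ne]
      rintro rfl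
      exact hd he
  obtain ⟨b, c, hb, hc, rfl⟩ := exists_dvd_and_dvd_of_dvd_mul ha
  have hp : Prime (T 1 - 1 : ℚ[T;T⁻¹]) := by
    rw [← laurentCyclotomic_one]; exact prime_laurentCyclotomic_rat one_pos
  obtain ⟨ε, hε, hb'⟩ := (dvd_prime_pow hp 1).1 (by simpa using hb)
  obtain ⟨j, hj⟩ := key t ht c hc
  exact ⟨ε, j, hε, hb'.mul_mul hj⟩

/-- Evaluate a Bézout identity between `Φ_d` and `Φ_1 = t - 1` at `t = 1`. -/
theorem eval_one_laurentCyclotomic_ne_zero {F K : Type*} [Field F] [CharZero F] [Field K]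
    (f : F[T;T⁻¹] →+* K) (hf : f (T 1) = 1) {d : ℕ} (hd : d ≠ 1) :
    f (laurentCyclotomic F d) ≠ 0 := by
  intro h
  obtain ⟨a, b, hab⟩ := isCoprime_laurentCyclotomic F hd
  have := congrArg f hab
  simp [h, laurentCyclotomic_one, hf] at this

/-- The value is a factor of `2^d - 1`, which is nonzero in characteristic zero. -/
theorem eval_two_laurentCyclotomic_ne_zero {F K : Type*} [Field F] [Field K] [CharZero K]
    (f : F[T;T⁻¹] →+* K) (hf : f (T 1) = 2) {d : ℕ} (hd : 0 < d) :
    f (laurentCyclotomic F d) ≠ 0 := by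
  intro h
  have h1 := congrArg f (prod_laurentCyclotomic F hd)
  rw [map_prod, Finset.prod_eq_zero (Nat.mem_divisors_self d hd.ne') h, map_sub, map_one] at h1
  have h2 : f (T d) = 2 ^ d := by
    rw [← hf, ← map_pow, T_pow, mul_one]
  rw [h2] at h1
  have h3 : ((2 ^ d : ℕ) : K) = (1 : ℕ) := by
    push_cast
    exact (sub_eq_zero.1 h1.symm)
  have h4 := Nat.cast_injective h3
  exact (Nat.one_lt_two_pow hd.ne').ne' h4

end DivisorForm

/-! ### Change of coefficients and specialization of the Fox matrix -/

namespace EvenLabeledGraph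

open LaurentPolynomial

variable {V : Type u} [DecidableEq V] {Γ : EvenLabeledGraph V}
  {χ : Γ.ArtinGroup →* Multiplicative ℤ}

theorem map_edgeRelation {A B : Type*} [CommRing A] [CommRing B] (f : A →+* B) (m : V → ℤ) (k : ℕ)
    (v w : V) :
    (fun x => laurentMap f (edgeRelation A m k v w x)) = edgeRelation B m k v w := by
  have hs : ∀ v x : V, laurentMap f ((Pi.single v 1 : V → A[T;T⁻¹]) x) =
      (Pi.single v 1 : V → B[T;T⁻¹]) x := fun v x => by
    rcases eq_or_ne x v with rfl | h
    · simp
    · simp [h]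
  ext1 x
  simp only [edgeRelation, Pi.smul_apply, Pi.sub_apply, smul_eq_mul, map_mul, map_sub, map_sum,
    map_pow, map_one, laurentMap_T, hs]

theorem map_foxDerivative {A B : Type*} [CommRing A] [CommRing B] (f : A →+* B) (m : V → ℤ)
    (w : FreeGroup V) :
    (fun x => laurentMap f (foxDerivative A m (fun v => (Pi.single v 1 : V → A[T;T⁻¹])) w x)) =
      foxDerivative B m (fun v => (Pi.single v 1 : V → B[T;T⁻¹])) w := by
  let F : (V → A[T;T⁻¹]) →+ (V → B[T;T⁻¹]) := (laurentMap f : A[T;T⁻¹] →+ B[T;T⁻¹]).compLeft V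
  have h1 := (isCrossed_foxDerivative (A := A) m
    (fun v => (Pi.single v 1 : V → A[T;T⁻¹]))).map_semilinear (B := B) F (fun n x => by
      ext1 v
      simp [F, laurentMap_T])
  refine h1.eq_of_freeGroup (isCrossed_foxDerivative (A := B) m
    (fun v => (Pi.single v 1 : V → B[T;T⁻¹]))) (fun v => ?_) w
  ext1 x
  rcases eq_or_ne x v with rfl | h
  · simp [F]
  · simp [F, h]

/-- The Fox derivatives are compatible with changes of the coefficients. -/
theorem image_foxRelations {A B : Type*} [CommRing A] [CommRing B] (f : A →+* B)
    (w : FreeGroup V) :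
    (fun x v => laurentMap f (x v)) '' foxRelations A χ w = foxRelations B χ w := by
  rw [foxRelations, foxRelations, Set.image_insert_eq, map_foxDerivative]
  congr 1
  ext r
  constructor
  · rintro ⟨_, ⟨a, b, h, rfl⟩, rfl⟩
    exact ⟨a, b, h, map_edgeRelation f _ _ _ _⟩
  · rintro ⟨a, b, h, rfl⟩
    exact ⟨_, ⟨a, b, h, rfl⟩, map_edgeRelation f _ _ _ _⟩

variable [Fintype V]

/-! ### Specializations at `t = 1` and `t = 2` -/

/-- Every edge relation contains factors `1 - t^m` and vanishes at `t = 1`, while the row of `w`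
survives because `∑ b_v u_v = 1`. -/
theorem finrank_span_eval_one {F K : Type*} [Field F] [Field K]
    (f : F[T;T⁻¹] →+* K) (hf : ∀ n, f (T n) = 1) (hres : NonResonant χ) (w : FreeGroup V)
    (hw : χ (PresentedGroup.mk _ w) = Multiplicative.ofAdd 1) :
    Module.finrank K (Submodule.span K ((fun x v => f (x v)) '' foxRelations F χ w)) = 1 := by
  choose u hu hu' using fun v => exists_T_sub_one_eq F (hres v)
  set b := foxDerivative F (weight χ) (fun v => (Pi.single v 1 : V → F[T;T⁻¹])) w with hb
  have h1 : ∑ v, b v * u v = 1 := sum_foxDerivative_mul_factor F w hw u hu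
  have hb0 : (fun v => f (b v)) ≠ 0 := by
    intro h0
    have h2 := congrArg f h1
    rw [map_sum, map_one] at h2
    refine zero_ne_one (α := K) (Eq.trans (Eq.symm ?_) h2)
    exact Finset.sum_eq_zero fun v _ => by rw [map_mul, show f (b v) = 0 from congrFun h0 v, zero_mul]
  rw [foxRelations, Set.image_insert_eq, Submodule.span_insert]
  rw [sup_eq_left.2]
  · exact finrank_span_singleton hb0
  · refine Submodule.span_le.2 ?_
    rintro _ ⟨_, ⟨a, b, h, rfl⟩, rfl⟩
    have h0 : (fun v => f (edgeRelation F (weight χ) (Γ.halfLabel h) a b v)) = 0 := by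
      ext x
      simp [edgeRelation, hf]
    change (fun v => f (edgeRelation F (weight χ) (Γ.halfLabel h) a b v)) ∈ _
    rw [h0]
    exact Submodule.zero_mem _

omit [DecidableEq V] [Fintype V] in
theorem flagBoundary_range_le_ker (K : Type u) [Field K] :
    LinearMap.range (Γ.flagBoundary₁ K) ≤ LinearMap.ker (flagAugmentation K) := by
  rw [flagBoundary₁, Finsupp.range_linearCombination]
  refine Submodule.span_le.2 ?_
  rintro _ ⟨e, rfl⟩
  simp [flagAugmentation]

omit [DecidableEq V] in
-- The augmentation is onto when there is a vertex, so its kernel has dimension `|V| - 1`.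
theorem freeRank_add_boundaryRank [Nonempty V] (K : Type u) [Field K] :
    Γ.freeRank K + Γ.boundaryRank K + 1 = Fintype.card V := by
  have h1 := LinearMap.finrank_range_add_finrank_ker (flagAugmentation (V := V) K)
  have hsurj : Function.Surjective (flagAugmentation (V := V) K) := fun y => by
    obtain ⟨v⟩ := ‹Nonempty V›
    exact ⟨Finsupp.single v y, by simp [flagAugmentation]⟩
  rw [LinearMap.range_eq_top.2 hsurj, finrank_top, Module.finrank_self,
    Module.finrank_finsupp_self] at h1
  have h2 := Submodule.finrank_quotient_add_finrank (R := K) (M := LinearMap.ker (flagAugmentation K))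
    ((LinearMap.range (Γ.flagBoundary₁ K)).submoduleOf (LinearMap.ker (flagAugmentation K)))
  rw [(Submodule.submoduleOfEquivOfLe (flagBoundary_range_le_ker K)).finrank_eq] at h2
  have h3 : Γ.freeRank K + Γ.boundaryRank K = Module.finrank K _ := h2
  rw [h3, add_comm]
  exact h1

theorem two_zpow_ne_one {K : Type*} [Field K] [CharZero K] {m : ℤ} (hm : m ≠ 0) :
    (2 : K) ^ m ≠ 1 := by
  intro h
  have h1 : ((2 ^ m : ℚ) : K) = ((1 : ℚ) : K) := by push_cast; exact h
  have h2 : (2 : ℚ) ^ m = 2 ^ (0 : ℤ) := by simpa using Rat.cast_injective h1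
  exact hm (zpow_right_injective₀ (by norm_num) (by norm_num) h2)

/-- Rescaling the coordinate `v` by `2^{m_v} - 1 ≠ 0` turns each edge relation into a nonzero
multiple of the boundary of the edge, so these span `im ∂₁`. The row of `w` becomes a vector of
augmentation `2 - 1 = 1`, hence independent of `im ∂₁`. -/
theorem finrank_span_eval_two {F : Type*} {K : Type u} [Field F] [Field K] [CharZero K]
    (f : F[T;T⁻¹] →+* K) (hf : ∀ n, f (T n) = 2 ^ n) (hres : NonResonant χ) (w : FreeGroup V)
    (hw : χ (PresentedGroup.mk _ w) = Multiplicative.ofAdd 1) :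
    Module.finrank K (Submodule.span K ((fun x v => f (x v)) '' foxRelations F χ w)) =
      Γ.boundaryRank K + 1 := by
  let c : V → K := fun v => 2 ^ weight χ v - 1
  have hc : ∀ v, c v ≠ 0 := fun v => sub_ne_zero.2 (two_zpow_ne_one (hres v))
  let E : (V → K) ≃ₗ[K] (V →₀ K) :=
    (LinearEquiv.piCongrRight fun v => LinearEquiv.smulOfNeZero K K (c v) (hc v)) ≪≫ₗ
      (Finsupp.linearEquivFunOnFinite K K V).symm
  have hE : ∀ x v, E x v = c v * x v := fun x v => rfl
  set b := foxDerivative F (weight χ) (fun v => (Pi.single v 1 : V → F[T;T⁻¹])) w with hb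
  -- The geometric sum is positive over `ℚ`, hence nonzero in `K`.
  have hq : ∀ {v w : V} (h : Γ.graph.Adj v w), (∑ i ∈ Finset.range (Γ.halfLabel h),
      ((2 : K) ^ (weight χ v + weight χ w)) ^ i) ≠ 0 := fun {v w} h => by
    have h1 : (∑ i ∈ Finset.range (Γ.halfLabel h),
        ((2 : ℚ) ^ (weight χ v + weight χ w)) ^ i) ≠ 0 :=
      (Finset.sum_pos (fun i _ => by positivity) ⟨0, by simpa using halfLabel_pos h⟩).ne'
    have h2 := (Rat.cast_ne_zero (α := K)).2 h1
    push_cast at h2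
    exact h2
  have hrel : ∀ (a b : V) (h : Γ.graph.Adj a b),
      E (fun x => f (edgeRelation F (weight χ) (Γ.halfLabel h) a b x)) =
        ((∑ i ∈ Finset.range (Γ.halfLabel h), ((2 : K) ^ (weight χ a + weight χ b)) ^ i) *
          (c a * c b)) • (Finsupp.single b (1 : K) - Finsupp.single a (1 : K)) := fun a b h => by
    ext x
    rw [hE]
    have hab := h.ne
    simp only [edgeRelation, Pi.smul_apply, Pi.sub_apply, smul_eq_mul, map_mul, map_sub, map_sum,
      map_pow, map_one, hf, Finsupp.smul_apply, Finsupp.sub_apply]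
    rcases eq_or_ne x a with rfl | hxa
    · simp [hab, c]
      ring
    · rcases eq_or_ne x b with rfl | hxb
      · simp [hab.symm, c]
        ring
      · simp [hxa, hxb]
  have hmap : (Submodule.span K ((fun x v => f (x v)) '' foxRelations F χ w)).map
      (E : (V → K) →ₗ[K] (V →₀ K)) =
      Submodule.span K {E fun v => f (b v)} ⊔ LinearMap.range (Γ.flagBoundary₁ K) := by
    rw [foxRelations, Set.image_insert_eq, Submodule.span_insert, Submodule.map_sup,
      Submodule.map_span, Set.image_singleton, Submodule.map_span, flagBoundary₁,
      Finsupp.range_linearCombination]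
    congr 1
    refine le_antisymm (Submodule.span_le.2 ?_) (Submodule.span_le.2 ?_)
    · rintro _ ⟨_, ⟨_, ⟨a, b, h, rfl⟩, rfl⟩, rfl⟩
      refine (hrel a b h).symm ▸ Submodule.smul_mem _ _ (Submodule.subset_span ⟨⟨(a, b), h⟩, rfl⟩)
    · rintro _ ⟨⟨⟨a, b⟩, h⟩, rfl⟩
      have h1 := mul_ne_zero (hq h) (mul_ne_zero (hc a) (hc b))
      refine (Submodule.smul_mem_iff _ h1).1 ?_
      refine Eq.subst (motive := (· ∈ _)) (hrel a b h) (Submodule.subset_span ?_)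
      exact ⟨_, ⟨_, ⟨a, b, h, rfl⟩, rfl⟩, rfl⟩
  have haug : flagAugmentation K (E fun v => f (b v)) = 1 := by
    have h := congrArg f (sum_foxDerivative_mul (A := F) (weight χ) w)
    rw [freeCharacter_eq, MonoidHom.comp_apply, hw, toAdd_ofAdd, ← hb] at h
    rw [flagAugmentation, Finsupp.linearCombination_apply, Finsupp.sum_fintype _ _ (by simp)]
    have e : f (T 1 - 1 : F[T;T⁻¹]) = 1 := by
      rw [map_sub, hf, map_one]; norm_num
    refine Eq.trans ?_ (h.trans e)
    rw [map_sum]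
    refine Finset.sum_congr rfl fun v _ => ?_
    rw [hE, map_mul, map_sub, hf, map_one, smul_eq_mul, mul_one, mul_comm]
  have hE0 : (E fun v => f (b v)) ≠ 0 := fun h0 => by
    rw [h0, map_zero] at haug
    exact zero_ne_one haug
  have hdisj : Submodule.span K {E fun v => f (b v)} ⊓ LinearMap.range (Γ.flagBoundary₁ K) = ⊥ := by
    refine (Submodule.eq_bot_iff _).2 ?_
    rintro x ⟨hx, hx'⟩
    obtain ⟨r, rfl⟩ := Submodule.mem_span_singleton.1 hx
    have h0 : flagAugmentation K (r • E fun v => f (b v)) = 0 := flagBoundary_range_le_ker K hx'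
    rw [map_smul, haug, smul_eq_mul, mul_one] at h0
    rw [h0, zero_smul]
  have hfin := Submodule.finrank_sup_add_finrank_inf_eq (Submodule.span K {E fun v => f (b v)})
    (LinearMap.range (Γ.flagBoundary₁ K))
  rw [hdisj, finrank_bot, finrank_span_singleton hE0] at hfin
  rw [← LinearEquiv.finrank_map_eq E, hmap, boundaryRank]
  lia

end EvenLabeledGraph

section TwoSummands

/-- A direct sum with at most two nonzero summands. -/
theorem nonempty_directSum_equiv_prod {R : Type*} [CommRing R] {ι : Type*} [DecidableEq ι]
    (A : ι → Type*) [∀ i, AddCommGroup (A i)] [∀ i, Module R (A i)] {i₀ i₁ : ι} (h01 : i₀ ≠ i₁)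
    (h : ∀ i, i ≠ i₀ → i ≠ i₁ → Subsingleton (A i)) :
    Nonempty ((⨁ i, A i) ≃ₗ[R] A i₀ × A i₁) := by
  refine ⟨LinearEquiv.ofLinearMap
    (LinearMap.prod (DirectSum.component R ι A i₀) (DirectSum.component R ι A i₁))
    (LinearMap.coprod (DirectSum.lof R ι A i₀) (DirectSum.lof R ι A i₁)) ?_ ?_⟩
  · refine LinearMap.prod_ext ?_ ?_ <;> ext x <;>
      simp [DirectSum.component.of, h01, h01.symm]
  · refine DirectSum.linearMap_ext R fun i => LinearMap.ext fun x => ?_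
    rcases eq_or_ne i i₀ with rfl | hi
    · simp [DirectSum.component.of, h01]
    · rcases eq_or_ne i i₁ with rfl | hi'
      · simp [DirectSum.component.of, hi]
      · have := h i hi hi'
        rw [Subsingleton.elim x 0]
        simp

end TwoSummands

/-! ### Existence of the decomposition and the bound on exponents -/

namespace EvenLabeledGraph

open LaurentPolynomial

variable {V : Type u} [DecidableEq V] [Fintype V] {Γ : EvenLabeledGraph V}
  {χ : Γ.ArtinGroup →* Multiplicative ℤ}

omit [DecidableEq V] [Fintype V] in
theorem one_lt_of_mem_torsionOrders {d : ℕ} (hd : d ∈ torsionOrders χ) : 1 < d := hd.1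

omit [DecidableEq V] in
/-- The entries of a diagonal presentation matrix determine a decomposition. -/
theorem exists_hasDecomposition_quotient (K : Type u) [Field K] [CharZero K]
    (hres : NonResonant χ) (f : ℚ →+* K) {a : ℚ[T;T⁻¹]} (ha : a ∣ torsionAnnihilator ℚ hres)
    (f₁ : ℚ[T;T⁻¹] →+* K) (hf₁ : f₁ (T 1) = 1) :
    HasDecomposition K (torsionOrders χ) (K[T;T⁻¹] ⧸ Ideal.span {laurentMap f a}) 0
      (by classical exact if f₁ a = 0 then 1 else 0) := by
  classical
  set t := (finite_torsionOrders hres).toFinset with ht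
  have hmem : ∀ d ∈ t, d ∈ torsionOrders χ := fun d hd => by simpa [ht] using hd
  obtain ⟨ε, j, hε, hass⟩ := exists_associated_of_dvd t
    (fun d hd => zero_lt_one.trans (one_lt_of_mem_torsionOrders (hmem d hd))) ha
  -- Since `Φ_d(1) ≠ 0` for `d > 1`, the exponent of `t - 1` in `a` is detected by whether `a`
  -- vanishes at `t = 1`.
  have hε' : (if f₁ a = 0 then 1 else 0) = ε := by
    have h1 := hass.map f₁
    have h2 : ∏ d ∈ t, f₁ (laurentCyclotomic ℚ d) ^ j d ≠ 0 :=
      Finset.prod_ne_zero_iff.2 fun d hd => pow_ne_zero _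
        (eval_one_laurentCyclotomic_ne_zero f₁ hf₁ (one_lt_of_mem_torsionOrders (hmem d hd)).ne')
    have h3 : f₁ ((T 1 - 1) ^ ε * ∏ d ∈ t, laurentCyclotomic ℚ d ^ j d) =
        0 ^ ε * ∏ d ∈ t, f₁ (laurentCyclotomic ℚ d) ^ j d := by
      simp [hf₁]
    rw [h3] at h1
    rw [h1.eq_zero_iff]
    rcases Nat.le_one_iff_eq_zero_or_eq_one.1 hε with rfl | rfl
    · simpa using h2
    · simp
  rw [hε']
  have h4 := hass.map (laurentMap f)
  rw [map_mul, map_pow, map_sub, map_one, laurentMap_T, map_prod] at h4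
  simp only [map_pow, laurentMap_cyclotomic] at h4
  exact hasDecomposition_quotient_congr h4.symm (hasDecomposition_quotient_mul_prod t hmem
    (fun h => (one_lt_of_mem_torsionOrders (hmem 1 h)).ne rfl) j hε)

theorem hasDecomposition_kerHomology (K : Type u) [Field K] [CharZero K]
    (hres : NonResonant χ) (g : Γ.ArtinGroup) (hg : χ g = Multiplicative.ofAdd 1) :
    HasDecomposition K (torsionOrders χ) (KerHomology K χ g 1) (Γ.freeRank K)
      (Γ.boundaryRank K) := by
  classical
  obtain ⟨w, hw⟩ := PresentedGroup.mk_surjective Γ.relators g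
  have hχw : χ (PresentedGroup.mk _ w) = Multiplicative.ofAdd 1 := by rw [hw, hg]
  -- Without vertices `χ` would be trivial and could not take the value `1` on `g`.
  have hV : Nonempty V := by
    by_contra hV
    rw [not_nonempty_iff] at hV
    have h1 : freeCharacter (weight χ) = 1 := by ext v; exact hV.elim v
    rw [← MonoidHom.comp_apply, ← freeCharacter_eq, h1] at hχw
    exact absurd (congrArg Multiplicative.toAdd hχw) (by simp)
  let f : ℚ →+* K := algebraMap ℚ K
  let f₁ : ℚ[T;T⁻¹] →+* K := eval₂ f 1
  have hf₁ : ∀ n, f₁ (T n) = 1 := fun n => by simp [f₁]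
  let f₂ : ℚ[T;T⁻¹] →+* K := eval₂ f (Units.mk0 2 two_ne_zero)
  have hf₂ : ∀ n, f₂ (T n) = 2 ^ n := fun n => by simp [f₂]
  have := isPrincipalIdealRing_laurent ℚ
  obtain ⟨a, P, P', hP, hP', hN⟩ := exists_span_smul_rows (foxSubmodule ℚ χ w)
  have hdvd : ∀ v, a v ≠ 0 → a v ∣ torsionAnnihilator ℚ hres :=
    dvd_of_smul_mem_span_rows hP hN
      fun x c hc hx => torsionAnnihilator_smul_mem ℚ hres w hχw x c hc hx
  have hD2 : f₂ (torsionAnnihilator ℚ hres) ≠ 0 := by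
    rw [torsionAnnihilator, map_mul, map_prod]
    refine mul_ne_zero ?_ (Finset.prod_ne_zero_iff.2 fun d hd => ?_)
    · rw [map_sub, hf₂, map_one]; norm_num
    · rw [map_pow]
      refine pow_ne_zero _ (eval_two_laurentCyclotomic_ne_zero f₂ (by rw [hf₂, zpow_one]) ?_)
      exact zero_lt_one.trans (one_lt_of_mem_torsionOrders (by simpa using hd))
  -- The nonzero diagonal entries divide the annihilator, which does not vanish at `t = 2`; so the
  -- rank at `t = 2` counts them exactly.
  have ha2 : ∀ v, f₂ (a v) ≠ 0 ↔ a v ≠ 0 := fun v =>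
    ⟨fun h h0 => h (by rw [h0, map_zero]), fun h h0 => by
      obtain ⟨z, hz⟩ := hdvd v h
      exact hD2 (by rw [hz, map_mul, h0, zero_mul])⟩
  obtain ⟨L₁, hL₁⟩ := exists_equiv_span_image f₁ _ a P P' hP hP' hN
  obtain ⟨L₂, hL₂⟩ := exists_equiv_span_image f₂ _ a P P' hP hP' hN
  obtain ⟨L, hL⟩ := exists_equiv_span_image (laurentMap f) _ a P P' hP hP' hN
  have hc1 := finrank_of_eq_map_span_single _ _ L₁ hL₁
  rw [finrank_span_eval_one f₁ hf₁ hres w hχw] at hc1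
  have hc2 := finrank_of_eq_map_span_single _ _ L₂ hL₂
  rw [finrank_span_eval_two f₂ hf₂ hres w hχw] at hc2
  rw [image_foxRelations] at hL
  obtain ⟨e₁⟩ := nonempty_kerHomology_equiv K χ g hg w hw
  obtain ⟨e₂⟩ := nonempty_quotient_equiv_pi _ _ L hL
  let r : V → ℕ := fun v => if a v = 0 then 1 else 0
  let s : V → ℕ := fun v => if a v = 0 then 0 else if f₁ (a v) = 0 then 1 else 0
  have hdec : ∀ v, HasDecomposition K (torsionOrders χ)
      (K[T;T⁻¹] ⧸ Ideal.span {laurentMap f (a v)}) (r v) (s v) := fun v => by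
    by_cases h0 : a v = 0
    · simp only [r, s, if_pos h0]
      exact hasDecomposition_free.of_equiv (Submodule.quotEquivOfEqBot _
        (by rw [h0, map_zero, Ideal.span_singleton_zero]))
    · simp only [r, s, if_neg h0]
      exact exists_hasDecomposition_quotient K hres f (hdvd v h0) f₁ (hf₁ 1)
  have h5 := (hasDecomposition_pi _ r s hdec).of_equiv (e₁.trans e₂)
  have h6 : ∑ v, r v + Nat.card {v // f₂ (a v) ≠ 0} = Fintype.card V := by
    simp only [ha2, Nat.card_eq_fintype_card, Fintype.card_subtype]
    simp only [r, ← Finset.card_filter]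
    exact Finset.card_filter_add_card_filter_not _
  -- The entries vanishing at `t = 1` are the zero ones, counted by `r`, and the nonzero ones
  -- divisible by `t - 1`, counted by `s`.
  have h7 : ∑ v, r v + ∑ v, s v + Nat.card {v // f₁ (a v) ≠ 0} = Fintype.card V := by
    rw [Nat.card_eq_fintype_card, Fintype.card_subtype, Finset.card_filter,
      ← Finset.sum_add_distrib, ← Finset.sum_add_distrib, Fintype.card_eq_sum_ones]
    refine Finset.sum_congr rfl fun v _ => ?_
    by_cases h0 : a v = 0
    · simp [r, s, h0]
    · by_cases h1 : f₁ (a v) = 0 <;> simp [r, s, h0, h1]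
  have h8 := freeRank_add_boundaryRank (Γ := Γ) K
  have h9 : ∑ v, r v = Γ.freeRank K := by lia
  have h10 : ∑ v, s v = Γ.boundaryRank K := by lia
  rwa [h9, h10] at h5

omit [DecidableEq V] in
-- After cancelling `Φ_d²`, the remaining factors are coprime to `Φ_d`, including `t - 1 = Φ_1`
-- because `d > 1`; and `Φ_d` is not a unit.
theorem pow_three_not_dvd_torsionAnnihilator (K : Type*) [Field K] [CharZero K]
    (hres : NonResonant χ) {d : ℕ} (hd : d ∈ torsionOrders χ) :
    ¬ laurentCyclotomic K d ^ 3 ∣ torsionAnnihilator K hres := by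
  intro h
  have h1d := one_lt_of_mem_torsionOrders hd
  rw [torsionAnnihilator, ← Finset.mul_prod_erase _ _
    ((finite_torsionOrders hres).mem_toFinset.2 hd), mul_left_comm, pow_succ] at h
  have h1 := (mul_dvd_mul_iff_left (pow_ne_zero 2 (laurentCyclotomic_ne_zero K d))).1 h
  have hco : IsCoprime (laurentCyclotomic K d) ((T 1 - 1) *
      ∏ e ∈ (finite_torsionOrders hres).toFinset.erase d, laurentCyclotomic K e ^ 2) := by
    refine IsCoprime.mul_right ?_ (IsCoprime.prod_right fun e he => ?_)
    · rw [← laurentCyclotomic_one]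
      exact isCoprime_laurentCyclotomic K h1d.ne'
    · exact (isCoprime_laurentCyclotomic K (Finset.ne_of_mem_erase he).symm).pow_right
  exact not_isUnit_laurentCyclotomic K (zero_lt_one.trans h1d) (hco.isUnit_of_dvd h1)

theorem torsionAnnihilator_smul_eq_zero (K : Type u) [Field K] [CharZero K]
    (hres : NonResonant χ) (g : Γ.ArtinGroup) (hg : χ g = Multiplicative.ofAdd 1)
    (x : KerHomology K χ g 1) (c : K[T;T⁻¹]) (hc : c ≠ 0) (hx : c • x = 0) :
    torsionAnnihilator K hres • x = 0 := by
  obtain ⟨w, hw⟩ := PresentedGroup.mk_surjective Γ.relators g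
  have hχw : χ (PresentedGroup.mk _ w) = Multiplicative.ofAdd 1 := by rw [hw, hg]
  obtain ⟨e⟩ := nonempty_kerHomology_equiv K χ g hg w hw
  obtain ⟨y, hy⟩ := Submodule.Quotient.mk_surjective _ (e x)
  refine e.injective ?_
  have h1 := congrArg e hx
  rw [map_smul, map_zero, ← hy, ← Submodule.Quotient.mk_smul, Submodule.Quotient.mk_eq_zero] at h1
  rw [map_smul, map_zero, ← hy, ← Submodule.Quotient.mk_smul, Submodule.Quotient.mk_eq_zero]
  exact torsionAnnihilator_smul_mem K hres w hχw y c hc h1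

/-- The generator of a summand `R / (Φ_d^j)` is torsion with annihilator exactly `(Φ_d^j)`, so
`Φ_d^j` would divide the torsion annihilator. The ranks `r` and `s` of the decomposition play no
role. -/
theorem eq_zero_of_two_lt (K : Type u) [Field K] [CharZero K]
    (hres : NonResonant χ) (g : Γ.ArtinGroup) (hg : χ g = Multiplicative.ofAdd 1) {r s : ℕ}
    {n : torsionOrders χ → ℕ+ → ℕ}
    (e : KerHomology K χ g 1 ≃ₗ[K[T;T⁻¹]] DecomposedModule K (torsionOrders χ) r s n)
    (d : torsionOrders χ) (j : ℕ+) (hj : 2 < j) : n d j = 0 := by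
  classical
  by_contra hn
  let i : Fin (n d j) := ⟨0, Nat.pos_of_ne_zero hn⟩
  let ι : CyclotomicSummand K d j →ₗ[K[T;T⁻¹]] DecomposedModule K (torsionOrders χ) r s n :=
    LinearMap.inr _ _ _ ∘ₗ LinearMap.inr _ _ _ ∘ₗ
      DirectSum.lof K[T;T⁻¹] (torsionOrders χ)
        (fun d => ⨁ j : ℕ+, (Fin (n d j) → CyclotomicSummand K d j)) d ∘ₗ
      DirectSum.lof K[T;T⁻¹] ℕ+ (fun j : ℕ+ => (Fin (n d j) → CyclotomicSummand K d j)) j ∘ₗ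
      LinearMap.single K[T;T⁻¹] (fun _ => CyclotomicSummand K d j) i
  have hι : Function.Injective ι :=
    LinearMap.inr_injective.comp (LinearMap.inr_injective.comp
      ((DirectSum.of_injective d).comp ((DirectSum.of_injective j).comp
        (Pi.single_injective (M := fun _ : Fin (n d j) => CyclotomicSummand K d j) i))))
  have hann : ∀ c : K[T;T⁻¹], c • (Ideal.Quotient.mk _ 1 : CyclotomicSummand K d j) = 0 ↔
      laurentCyclotomic K d ^ (j : ℕ) ∣ c := fun c => by
    rw [← Ideal.mem_span_singleton, ← Ideal.Quotient.eq_zero_iff_mem, ← Ideal.Quotient.mk_eq_mk,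
      ← Submodule.Quotient.mk_smul, smul_eq_mul, mul_one]
    exact Iff.rfl
  have h1 := torsionAnnihilator_smul_eq_zero K hres g hg
    (e.symm (ι (Ideal.Quotient.mk _ 1))) (laurentCyclotomic K d ^ (j : ℕ))
    (pow_ne_zero _ (laurentCyclotomic_ne_zero K d)) (by
      rw [← map_smul, ← map_smul, (hann _).2 dvd_rfl, map_zero, map_zero])
  rw [← map_smul, ← map_smul, LinearEquiv.map_eq_zero_iff, map_eq_zero_iff ι hι, hann] at h1
  exact pow_three_not_dvd_torsionAnnihilator K hres d.2 ((pow_dvd_pow _ hj).trans h1)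

end EvenLabeledGraph

theorem mainTheorem3 {V : Type u} [Fintype V] (Γ : EvenLabeledGraph V)
    (K : Type u) [Field K] [CharZero K]
    (χ : Γ.ArtinGroup →* Multiplicative ℤ) (hχ : Function.Surjective χ)
    (hres : EvenLabeledGraph.NonResonant χ)
    (g : Γ.ArtinGroup) (hg : χ g = Multiplicative.ofAdd 1) :
    (∃ n : EvenLabeledGraph.torsionOrders χ → ℕ+ → ℕ,
      Nonempty (KerHomology K χ g 1 ≃ₗ[K[T;T⁻¹]]
        (Fin (Γ.freeRank K) → K[T;T⁻¹]) × (Fin (Γ.boundaryRank K) → TrivialSummand K) ×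
          ⨁ d : EvenLabeledGraph.torsionOrders χ, ⨁ j : ℕ+,
            (Fin (n d j) → CyclotomicSummand K d j))) ∧
    ∀ n : EvenLabeledGraph.torsionOrders χ → ℕ+ → ℕ,
      Nonempty (KerHomology K χ g 1 ≃ₗ[K[T;T⁻¹]]
        (Fin (Γ.freeRank K) → K[T;T⁻¹]) × (Fin (Γ.boundaryRank K) → TrivialSummand K) ×
          ⨁ d : EvenLabeledGraph.torsionOrders χ, ⨁ j : ℕ+,
            (Fin (n d j) → CyclotomicSummand K d j)) →
      (∀ d j, 2 < j → n d j = 0) ∧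
      Nonempty (KerHomology K χ g 1 ≃ₗ[K[T;T⁻¹]]
        (Fin (Γ.freeRank K) → K[T;T⁻¹]) × (Fin (Γ.boundaryRank K) → TrivialSummand K) ×
          ⨁ d : EvenLabeledGraph.torsionOrders χ,
            (Fin (n d 1) → CyclotomicSummand K d 1) ×
              (Fin (n d 2) → CyclotomicSummand K d 2)) := by
  classical
  refine ⟨EvenLabeledGraph.hasDecomposition_kerHomology K hres g hg, ?_⟩
  rintro n ⟨e⟩
  have hn := EvenLabeledGraph.eq_zero_of_two_lt K hres g hg e
  refine ⟨hn, ?_⟩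
  have e' := fun d : EvenLabeledGraph.torsionOrders χ =>
    (nonempty_directSum_equiv_prod (R := K[T;T⁻¹])
      (fun j : ℕ+ => (Fin (n d j) → CyclotomicSummand K d j)) (i₀ := 1) (i₁ := 2) (by decide)
      (fun j h1 h2 => by
        have : n d j = 0 := hn d j (by
          have h1' : (j : ℕ) ≠ 1 := fun h => h1 (PNat.eq h)
          have h2' : (j : ℕ) ≠ 2 := fun h => h2 (PNat.eq h)
          have := j.pos
          exact (PNat.coe_lt_coe 2 j).1 (by change 2 < (j : ℕ); lia))
        rw [this]; infer_instance)).some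
  exact ⟨e.trans ((LinearEquiv.refl _ _).prodCongr ((LinearEquiv.refl _ _).prodCongr
    (DFinsupp.mapRange.linearEquiv e')))⟩

end
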